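/- All graphs are finite, undirected and simple. For a connected graph $G$ let $W_e(G)=\sum_{\{f,g\}\subseteq E(G)} d_G(f,g)$ be its edge-Wiener index, where $d_G(f,g)$ is the distance of $f$ and $g$ as vertices of the line graph of $G$. A cactus is a connected graph in which any two distinct cycles have at most one common vertex; $\mathcal{G}_{n,t}$ is the set of cacti with $n$ vertices and exactly $t$ cycles. For $i,j,l\ge 0$ the saw graph $Sw(i,j;l)$ is obtained from a path $v_0v_1\cdots v_{i+l+j}$ by adding, for each of its first $i$ edges and each of its last $j$ edges, a new vertex adjacent to exactly the two ends of that edge; thus it consists of two triangle chains of lengths $i$ and $j$ joined end to end by a path with $l$ edges, and has $2i+2j+l+1$ vertices. Theorem. Let $n\ge 5$, $t\ge 0$ and $G\in\mathcal{G}_{n,t}$. (i) If $t=2k$ with $k\ge 0$, then $$W_e(G)\le \tfrac16 n^3-\tfrac12 n^2+\tfrac13 n+kn^2-4k^2n+\tfrac43k^3+8k^2-\tfrac{10}{3}k,$$ with equality if and only if $G\cong Sw(k,k;n-4k-1)$. (ii) If $t=2k+1$ with $k\ge 0$, then $$W_e(G)\le \tfrac16 n^3-\tfrac{13}{6}n+kn^2-4k^2n-4kn+\tfrac43k^3+10k^2+\tfrac{35}{3}k+5,$$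 with equality if and only if $G\cong Sw(k,k+1;n-4k-3)$ or $G\cong C_5$, the cycle on five vertices (the latter is possible only for $n=5$, $t=1$). -/

import Mathlib

namespace EdgeWienerCacti

/-- The cycles of `G`, as subgraphs: two closed walks that run through the same cycle from
different starting points or in different directions give the same element. -/
def cycles {V : Type*} (G : SimpleGraph V) : Set G.Subgraph :=
  {C | ∃ (v : V) (p : G.Walk v v), p.IsCycle ∧ p.toSubgraph = C}

/-- A cactus: a connected graph in which any two distinct cycles have at most one common vertex. -/
def IsCactus {V : Type*} (G : SimpleGraph V) : Prop :=
  G.Connected ∧ (cycles G).Pairwise fun C D => (C.verts ∩ D.verts).Subsingleton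

/-- `G` belongs to the class of cacti with `n` vertices and exactly `t` cycles. -/
def MemCacti {V : Type*} [Fintype V] (G : SimpleGraph V) (n t : ℕ) : Prop :=
  IsCactus G ∧ Fintype.card V = n ∧ (cycles G).ncard = t

/-- The distance between the two edges of an unordered pair of edges, i.e. the distance of the
corresponding vertices of the line graph. -/
noncomputable def edgePairDist {V : Type*} (G : SimpleGraph V) : Sym2 G.edgeSet → ℕ :=
  Sym2.lift ⟨fun f g => G.lineGraph.dist f g, fun _ _ => SimpleGraph.dist_comm⟩

open Classical in
/-- The edge-Wiener index: the sum of the distances of all unordered pairs of edges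
(a pair of two equal edges contributes `0`). -/
noncomputable def edgeWiener {V : Type*} [Fintype V] (G : SimpleGraph V) : ℕ :=
  ∑ p : Sym2 G.edgeSet, edgePairDist G p

/-- The generating relation of the saw graph. The vertices are the spine `0, 1, …, i + l + j`, the
tips of the `i` triangles of the left chain and the tips of the `j` triangles of the right chain.
The spine is a path; the left triangles stand on its first `i` edges, the right triangles stand on
its last `j` edges, and the `l` edges in between form the joining path. -/
def sawRel (i j l : ℕ) :
    Fin (i + l + j + 1) ⊕ (Fin i ⊕ Fin j) → Fin (i + l + j + 1) ⊕ (Fin i ⊕ Fin j) → Prop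
  | .inl x, .inl y => (y : ℕ) = x + 1
  | .inl x, .inr (.inl a) => (x : ℕ) = a ∨ (x : ℕ) = a + 1
  | .inl x, .inr (.inr b) => (x : ℕ) = i + l + b ∨ (x : ℕ) = i + l + b + 1
  | .inr _, _ => False

/-- The saw graph `Sw(i, j; l)`: a triangle chain of length `i` and a triangle chain of length `j`,
an end of the first joined to an end of the second by a path with `l` edges
(these ends are identified when `l = 0`; a triangle chain of length `0` is a single vertex). -/
def sawGraph (i j l : ℕ) : SimpleGraph (Fin (i + l + j + 1) ⊕ (Fin i ⊕ Fin j)) :=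
  SimpleGraph.fromRel (sawRel i j l)

end EdgeWienerCacti

/-!
# Cacti with the largest edge-Wiener index

The proof works inside a fixed connected graph `G`, with sets of vertices `A` whose distances are
measured in `G`. Two sets are glued at a vertex (`Glue`) when all shortest paths between them run
through that vertex; this purely metric notion makes distance sums and Wiener sums additive up to
explicit terms (`distSum_union`, `wienerSum_union`), and gluings can be reordered freely. A cactus
is built from one vertex by gluing on bridges and cycles (`Built`), and is measured by the number
`t` of its cycles and by `P = n - t - 1`, the largest diameter a cactus with `n` vertices and `t`
cycles can have. In these parameters it has `P + 2 * t` edges.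

The bound `maxWiener P t`, which is six times the largest index, is proved by induction
(`Built.bounded`).

* If there is a pendant edge, it is removed. The loss is governed by the distance sum of its
  attachment vertex, which is largest at the far end of a path followed by a chain of triangles
  (`Built.distSum_le`).
* Otherwise all end blocks are cycles. If there are at least two, choose two whose attachment
  vertices `w₁`, `w₂` are as far apart as possible, and remove both. Since `t` drops by two, the
  parity that distinguishes the two cases of the theorem is preserved. By the choice of the pair, no
  other end block is farther from `w₁` or `w₂` than these are from each other, and because the
  perimeter of a triple of vertices is at most `2 * P + 1` (`Built.dist_triple_le`) the two distance
  sums together are bounded by their value in a chain of bridges and triangles from `w₁` to `w₂`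
  (`Built.distSum_add_distSum_le`).
* A single cycle is computed directly. The cycle of length four violates the bound, which is why
  `5 ≤ n` is needed, and the cycle of length five attains it.

Equality in a step forces a saw graph for the rest, the attachment vertices at its two ends, and
triangles for the removed cycles. The removal of two triangles, one at each end, keeps the lengths of
the two triangle chains balanced. Saw graphs are handled through coordinates (`IsStrip`), which give
their Wiener sums and the isomorphisms with `sawGraph`.

A graph whose distinct cycles share at most one vertex is built in this way
(`IsCactus.exists_built`): a retraction onto the part already built, constant on everything that
hangs at one vertex, is extended over the bridge or the cycle through an edge that leaves this part.
Finally, line graph distances are expressed by distances of vertices (`lineGraph_dist`).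
-/

namespace EdgeWienerCacti
open Finset SimpleGraph
open scoped Classical
set_option linter.unusedSectionVars false

variable {V : Type*} [Fintype V] {G : SimpleGraph V}

/-! ### Distances between edges, and sums of such distances -/

/-- The distance of an edge `e` from a vertex `u`: the distance of `u` from the nearer end of
`e`. -/
noncomputable def edgeVertexDist (G : SimpleGraph V) (u : V) : Sym2 V → ℕ :=
  Sym2.lift ⟨fun a b => min (G.dist a u) (G.dist b u), fun _ _ => min_comm _ _⟩

/-- The least distance between an end of `e` and an end of `f`. For distinct edges this is one
less than the distance in the line graph. -/
noncomputable def edgeGap (G : SimpleGraph V) (e : Sym2 V) : Sym2 V → ℕ :=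
  Sym2.lift ⟨fun a b => min (edgeVertexDist G a e) (edgeVertexDist G b e), fun _ _ => min_comm _ _⟩

/-- The edges of `G` with both ends in `A`. -/
noncomputable def edgesIn (G : SimpleGraph V) (A : Finset V) : Finset (Sym2 V) :=
  univ.filter fun e => e ∈ G.edgeSet ∧ ∀ v ∈ e, v ∈ A

/-- The sum of the distances from `u` of the edges inside `A`, measured in the ambient graph. -/
noncomputable def distSum (G : SimpleGraph V) (A : Finset V) (u : V) : ℕ :=
  ∑ e ∈ edgesIn G A, edgeVertexDist G u e

/-- The sum of the line graph distances over the *ordered* pairs of edges inside `A`, measured in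
the ambient graph. -/
noncomputable def wienerSum (G : SimpleGraph V) (A : Finset V) : ℕ :=
  ∑ e ∈ edgesIn G A, ∑ f ∈ edgesIn G A, if e = f then 0 else edgeGap G e f + 1

@[simp] lemma edgeVertexDist_mk (u a b : V) :
    edgeVertexDist G u s(a, b) = min (G.dist a u) (G.dist b u) := rfl

@[simp] lemma edgeGap_mk (e : Sym2 V) (a b : V) :
    edgeGap G e s(a, b) = min (edgeVertexDist G a e) (edgeVertexDist G b e) := rfl

lemma edgeGap_comm (e f : Sym2 V) : edgeGap G e f = edgeGap G f e := by
  induction e using Sym2.ind with | _ a b =>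
  induction f using Sym2.ind with | _ x y =>
  simp only [edgeGap_mk, edgeVertexDist_mk, G.dist_comm (u := x), G.dist_comm (u := y)]
  omega

lemma mem_edgesIn {A : Finset V} {a b : V} :
    s(a, b) ∈ edgesIn G A ↔ G.Adj a b ∧ a ∈ A ∧ b ∈ A := by
  simp [edgesIn]

/-! ### Gluing at a vertex -/

/-- `A` and `K` meet in the vertex `x`, and every shortest path between them runs through `x`. -/
def Glue (G : SimpleGraph V) (A : Finset V) (x : V) (K : Finset V) : Prop :=
  x ∈ A ∧ x ∈ K ∧ ∀ a ∈ A, ∀ c ∈ K, G.dist a c = G.dist a x + G.dist x c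

lemma Glue.symm {A K : Finset V} {x : V} (h : Glue G A x K) : Glue G K x A :=
  ⟨h.2.1, h.1, fun a ha c hc => by
    rw [G.dist_comm, h.2.2 c hc a ha, G.dist_comm (u := c), G.dist_comm (u := a), add_comm]⟩

lemma Glue.mono {A B K : Finset V} {x : V} (h : Glue G A x K) (hB : B ⊆ A) (hx : x ∈ B) :
    Glue G B x K :=
  ⟨hx, h.2.1, fun a ha c hc => h.2.2 a (hB ha) c hc⟩

lemma Glue.eq (hG : G.Connected) {A K : Finset V} {x v : V} (h : Glue G A x K) (hA : v ∈ A)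
    (hK : v ∈ K) : v = x := by
  have := h.2.2 v hA v hK
  rw [SimpleGraph.dist_self] at this
  exact hG.dist_eq_zero_iff.1 (by omega)

lemma Glue.adj (hG : G.Connected) {A K : Finset V} {x a c : V} (h : Glue G A x K) (ha : a ∈ A)
    (hc : c ∈ K) (hac : G.Adj a c) : a = x ∨ c = x := by
  have := h.2.2 a ha c hc
  rw [SimpleGraph.dist_eq_one_iff_adj.2 hac] at this
  by_contra! hne
  have h1 := hG.pos_dist_of_ne hne.1
  have h2 := hG.pos_dist_of_ne hne.2.symm
  omega

/-- Two pieces glued to `A` one after the other, both at vertices of `A`, can be glued in the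
opposite order. -/
lemma Glue.comm {A K L : Finset V} {x y : V} (hK : Glue G A x K) (hL : Glue G (A ∪ K) y L)
    (hy : y ∈ A) : Glue G A y L ∧ Glue G (A ∪ L) x K := by
  refine ⟨hL.mono subset_union_left hy, mem_union_left _ hK.1, hK.2.1, fun a ha c hc => ?_⟩
  rcases mem_union.1 ha with ha | ha
  · exact hK.2.2 a ha c hc
  · have h1 := hL.2.2 c (mem_union_right _ hc) a ha
    have h2 := hL.2.2 x (mem_union_left _ hK.1) a ha
    have h3 := hK.2.2 y hy c hc
    rw [G.dist_comm (u := a), h1, G.dist_comm (u := a), h2, G.dist_comm (u := c), h3,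
      G.dist_comm (u := y)]
    omega

lemma edgesIn_union (hG : G.Connected) {A K : Finset V} {x : V} (h : Glue G A x K) :
    edgesIn G (A ∪ K) = edgesIn G A ∪ edgesIn G K := by
  ext e
  induction e using Sym2.ind with | _ a b =>
  simp only [mem_union, mem_edgesIn]
  constructor
  · rintro ⟨hab, ha | ha, hb | hb⟩
    · exact Or.inl ⟨hab, ha, hb⟩
    · rcases h.adj hG ha hb hab with rfl | rfl
      · exact Or.inr ⟨hab, h.2.1, hb⟩
      · exact Or.inl ⟨hab, ha, h.1⟩
    · rcases h.adj hG hb ha hab.symm with rfl | rfl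
      · exact Or.inr ⟨hab, ha, h.2.1⟩
      · exact Or.inl ⟨hab, h.1, hb⟩
    · exact Or.inr ⟨hab, ha, hb⟩
  · rintro (⟨h1, h2, h3⟩ | ⟨h1, h2, h3⟩)
    exacts [⟨h1, .inl h2, .inl h3⟩, ⟨h1, .inr h2, .inr h3⟩]

lemma disjoint_edgesIn (hG : G.Connected) {A K : Finset V} {x : V} (h : Glue G A x K) :
    Disjoint (edgesIn G A) (edgesIn G K) := by
  rw [Finset.disjoint_left]
  intro e
  induction e using Sym2.ind with | _ a b =>
  simp only [mem_edgesIn]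
  rintro ⟨hab, ha, hb⟩ ⟨-, ha', hb'⟩
  exact hab.ne ((h.eq hG ha ha').trans (h.eq hG hb hb').symm)

lemma card_edgesIn_union (hG : G.Connected) {A K : Finset V} {x : V} (h : Glue G A x K) :
    #(edgesIn G (A ∪ K)) = #(edgesIn G A) + #(edgesIn G K) := by
  rw [edgesIn_union hG h, card_union_of_disjoint (disjoint_edgesIn hG h)]

lemma card_union_of_glue (hG : G.Connected) {A K : Finset V} {x : V} (h : Glue G A x K) :
    #(A ∪ K) + 1 = #A + #K := by
  rw [← card_union_add_card_inter]
  congr 1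
  rw [eq_comm, card_eq_one]
  exact ⟨x, by ext v; simpa using ⟨fun hv => h.eq hG hv.1 hv.2, fun hv => hv ▸ ⟨h.1, h.2.1⟩⟩⟩

lemma edgeVertexDist_glue {A K : Finset V} {x a : V} (h : Glue G A x K) (ha : a ∈ A) {e : Sym2 V}
    (he : e ∈ edgesIn G K) : edgeVertexDist G a e = G.dist a x + edgeVertexDist G x e := by
  induction e using Sym2.ind with | _ b c =>
  obtain ⟨-, hb, hc⟩ := mem_edgesIn.1 he
  have h1 := h.2.2 a ha b hb
  have h2 := h.2.2 a ha c hc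
  simp only [edgeVertexDist_mk, G.dist_comm (u := b), G.dist_comm (u := c)]
  omega

lemma edgeGap_glue {A K : Finset V} {x : V} (h : Glue G A x K) {e f : Sym2 V}
    (he : e ∈ edgesIn G A) (hf : f ∈ edgesIn G K) :
    edgeGap G e f = edgeVertexDist G x e + edgeVertexDist G x f := by
  induction f using Sym2.ind with | _ b c =>
  obtain ⟨-, hb, hc⟩ := mem_edgesIn.1 hf
  rw [edgeGap_mk, edgeVertexDist_glue h.symm hb he, edgeVertexDist_glue h.symm hc he,
    edgeVertexDist_mk]
  omega

lemma distSum_union (hG : G.Connected) {A K : Finset V} {x a : V} (h : Glue G A x K)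
    (ha : a ∈ A) :
    distSum G (A ∪ K) a = distSum G A a + #(edgesIn G K) * G.dist a x + distSum G K x := by
  rw [distSum, edgesIn_union hG h, sum_union (disjoint_edgesIn hG h),
    sum_congr rfl (fun e he => edgeVertexDist_glue h ha he), sum_add_distrib, sum_const,
    smul_eq_mul, distSum, distSum, add_assoc]

/-- The Wiener sum of a gluing. The cross terms appear twice because the pairs are ordered. -/
lemma wienerSum_union (hG : G.Connected) {A K : Finset V} {x : V} (h : Glue G A x K) :
    wienerSum G (A ∪ K) = wienerSum G A + wienerSum G K +
      2 * (#(edgesIn G K) * distSum G A x + #(edgesIn G A) * distSum G K x +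
        #(edgesIn G A) * #(edgesIn G K)) := by
  have cross : ∀ {B L : Finset V}, Glue G B x L →
      (∑ e ∈ edgesIn G B, ∑ f ∈ edgesIn G L, if e = f then 0 else edgeGap G e f + 1) =
        #(edgesIn G L) * distSum G B x + #(edgesIn G B) * distSum G L x +
          #(edgesIn G B) * #(edgesIn G L) := by
    intro B L hBL
    have hne : ∀ e ∈ edgesIn G B, ∀ f ∈ edgesIn G L, e ≠ f := fun e he f hf hef =>
      (Finset.disjoint_left.1 (disjoint_edgesIn hG hBL)) he (hef ▸ hf)
    rw [sum_congr rfl (fun e he => sum_congr rfl (fun f hf => by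
      rw [if_neg (hne e he f hf), edgeGap_glue hBL he hf]))]
    simp only [sum_add_distrib, sum_const, smul_eq_mul, distSum, mul_one, ← mul_sum]
  rw [wienerSum, edgesIn_union hG h, sum_union (disjoint_edgesIn hG h)]
  simp only [sum_union (disjoint_edgesIn hG h), sum_add_distrib]
  rw [cross h, cross h.symm, wienerSum, wienerSum]
  ring

/-! ### Blocks: bridges and cycles -/

/-- `K` is a block with `r` vertices which lies isometrically in `G`: a cycle of length `r`, or, for
`r = 2`, the two ends of an edge. The vertices are `c 0, …, c (r - 1)` in cyclic order. -/
def IsRing (G : SimpleGraph V) (K : Finset V) (r : ℕ) (c : ℕ → V) : Prop :=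
  2 ≤ r ∧ K = (range r).image c ∧
    ∀ i j, i ≤ j → j < r → G.dist (c i) (c j) = min (j - i) (r - (j - i))

/-- The successor in the cyclic order of `0, …, r - 1`. -/
def next (r i : ℕ) : ℕ := if i + 1 < r then i + 1 else 0

lemma next_lt {r i : ℕ} (hr : 2 ≤ r) : next r i < r := by
  unfold next; split_ifs <;> omega

lemma IsRing.mem {K : Finset V} {r : ℕ} {c : ℕ → V} (h : IsRing G K r c) {i : ℕ} (hi : i < r) :
    c i ∈ K := by
  rw [h.2.1]; exact mem_image_of_mem _ (mem_range.2 hi)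

lemma IsRing.exists_eq {K : Finset V} {r : ℕ} {c : ℕ → V} (h : IsRing G K r c) {v : V}
    (hv : v ∈ K) : ∃ i < r, c i = v := by
  rw [h.2.1] at hv
  simpa using hv

lemma IsRing.dist_eq {K : Finset V} {r : ℕ} {c : ℕ → V} (h : IsRing G K r c) {i j : ℕ}
    (hi : i < r) (hj : j < r) :
    G.dist (c i) (c j) = min (i - j + (j - i)) (r - (i - j + (j - i))) := by
  rcases le_total i j with hij | hij
  · rw [h.2.2 i j hij hj]; congr 2 <;> omega
  · rw [G.dist_comm, h.2.2 j i hij hi]; congr 2 <;> omega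

lemma IsRing.injOn {K : Finset V} {r : ℕ} {c : ℕ → V} (h : IsRing G K r c) {i j : ℕ}
    (hi : i < r) (hj : j < r) (hij : c i = c j) : i = j := by
  have := h.dist_eq hi hj
  rw [hij, SimpleGraph.dist_self] at this
  omega

lemma IsRing.card {K : Finset V} {r : ℕ} {c : ℕ → V} (h : IsRing G K r c) : #K = r := by
  rw [h.2.1, card_image_of_injOn, card_range]
  intro i hi j hj hij
  exact h.injOn (by simpa using hi) (by simpa using hj) hij

/-- A block can be enumerated starting from any of its vertices. -/
lemma IsRing.rotate {K : Finset V} {r : ℕ} {c : ℕ → V} (h : IsRing G K r c) {x : V}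
    (hx : x ∈ K) : ∃ c', IsRing G K r c' ∧ c' 0 = x := by
  obtain ⟨s, hs, rfl⟩ := h.exists_eq hx
  have h2 := h.1
  have hlt : ∀ i, i < r → (if i + s < r then i + s else i + s - r) < r := by
    intro i hi; split_ifs <;> omega
  refine ⟨fun i => c (if i + s < r then i + s else i + s - r), ⟨h2, ?_, ?_⟩, by simp [hs]⟩
  · ext v
    constructor
    · intro hv
      obtain ⟨i, hi, rfl⟩ := h.exists_eq hv
      refine mem_image.2 ⟨if s ≤ i then i - s else i + r - s, mem_range.2 ?_, ?_⟩
      · split_ifs <;> omega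
      · congr 1; split_ifs <;> omega
    · intro hv
      obtain ⟨i, hi, rfl⟩ := mem_image.1 hv
      exact h.mem (hlt i (mem_range.1 hi))
  · intro i j hij hj
    rw [h.dist_eq (hlt i (by omega)) (hlt j hj)]
    split_ifs <;> omega

lemma IsRing.dist_triple_le {K : Finset V} {r : ℕ} {c : ℕ → V} (h : IsRing G K r c) {x y z : V}
    (hx : x ∈ K) (hy : y ∈ K) (hz : z ∈ K) : G.dist x y + G.dist x z + G.dist y z ≤ r := by
  obtain ⟨i, hi, rfl⟩ := h.exists_eq hx
  obtain ⟨j, hj, rfl⟩ := h.exists_eq hy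
  obtain ⟨k, hk, rfl⟩ := h.exists_eq hz
  rw [h.dist_eq hi hj, h.dist_eq hi hk, h.dist_eq hj hk]
  omega

lemma IsRing.two_mul_dist_le {K : Finset V} {r : ℕ} {c : ℕ → V} (h : IsRing G K r c) {x y : V}
    (hx : x ∈ K) (hy : y ∈ K) : 2 * G.dist x y ≤ r := by
  have := h.dist_triple_le hx hy hy
  rw [SimpleGraph.dist_self] at this
  omega

lemma IsRing.edgesIn {K : Finset V} {r : ℕ} {c : ℕ → V} (h : IsRing G K r c) :
    edgesIn G K = (range r).image fun i => s(c i, c (next r i)) := by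
  have h2 := h.1
  ext e
  induction e using Sym2.ind with | _ a b =>
  rw [mem_edgesIn]
  constructor
  · rintro ⟨hab, ha, hb⟩
    obtain ⟨i, hi, rfl⟩ := h.exists_eq ha
    obtain ⟨j, hj, rfl⟩ := h.exists_eq hb
    have hd := h.dist_eq hi hj
    rw [SimpleGraph.dist_eq_one_iff_adj.2 hab] at hd
    have : j = next r i ∨ i = next r j := by unfold next; split_ifs <;> omega
    rcases this with hj' | hi'
    · exact mem_image.2 ⟨i, mem_range.2 hi, by rw [← hj']⟩
    · exact mem_image.2 ⟨j, mem_range.2 hj, by rw [← hi', Sym2.eq_swap]⟩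
  · intro he
    obtain ⟨i, hi, hie⟩ := mem_image.1 he
    rw [mem_range] at hi
    have hn : next r i < r := next_lt h2
    have hadj : G.Adj (c i) (c (next r i)) := by
      rw [← SimpleGraph.dist_eq_one_iff_adj, h.dist_eq hi hn]
      unfold next; split_ifs <;> omega
    rcases Sym2.eq_iff.1 hie with ⟨rfl, rfl⟩ | ⟨rfl, rfl⟩
    · exact ⟨hadj, h.mem hi, h.mem hn⟩
    · exact ⟨hadj.symm, h.mem hn, h.mem hi⟩

lemma IsRing.edge_injOn {K : Finset V} {r : ℕ} {c : ℕ → V} (h : IsRing G K r c) (hr : 3 ≤ r) :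
    Set.InjOn (fun i => s(c i, c (next r i))) (range r) := by
  intro i hi j hj hij
  have hi : i < r := by simpa using hi
  have hj : j < r := by simpa using hj
  have hni : next r i < r := next_lt h.1
  have hnj : next r j < r := next_lt h.1
  rcases Sym2.eq_iff.1 hij with ⟨h1, -⟩ | ⟨h1, h2⟩
  · exact h.injOn hi hj h1
  · have e1 := h.injOn hi hnj h1
    have e2 := h.injOn hni hj h2
    unfold next at e1 e2
    split_ifs at e1 e2 <;> omega

lemma IsRing.card_edgesIn {K : Finset V} {r : ℕ} {c : ℕ → V} (h : IsRing G K r c) (hr : 3 ≤ r) :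
    #(EdgeWienerCacti.edgesIn G K) = r := by
  rw [h.edgesIn, card_image_of_injOn (h.edge_injOn hr), card_range]

lemma IsRing.edgesIn_two {K : Finset V} {c : ℕ → V} (h : IsRing G K 2 c) :
    EdgeWienerCacti.edgesIn G K = {s(c 0, c 1)} := by
  rw [h.edgesIn]
  ext e
  simp [range_add_one, next, Sym2.eq_swap]

lemma IsRing.card_edgesIn_two {K : Finset V} {c : ℕ → V} (h : IsRing G K 2 c) :
    #(EdgeWienerCacti.edgesIn G K) = 1 := by
  rw [h.edgesIn_two, card_singleton]

/-- The sum of the distances of the edges of a cycle of length `r` from one of its vertices. -/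
def ringDist (r : ℕ) : ℕ := ∑ i ∈ range r, min i (r - 1 - i)

/-- The sum of the distances of the edges of a cycle of length `r` from one of its edges, in the
line graph. -/
def ringTransmission (r : ℕ) : ℕ := ∑ i ∈ range r, min i (r - i)

lemma IsRing.distSum {K : Finset V} {r : ℕ} {c : ℕ → V} (h : IsRing G K r c) (hr : 3 ≤ r) {x : V}
    (hx : x ∈ K) : distSum G K x = ringDist r := by
  obtain ⟨c', h', rfl⟩ := h.rotate hx
  rw [EdgeWienerCacti.distSum, h'.edgesIn, sum_image (h'.edge_injOn hr), ringDist]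
  refine sum_congr rfl fun i hi => ?_
  rw [mem_range] at hi
  rw [edgeVertexDist_mk, h'.dist_eq hi (by omega), h'.dist_eq (next_lt h'.1) (by omega)]
  unfold next; split_ifs <;> omega

lemma IsRing.distSum_two {K : Finset V} {c : ℕ → V} (h : IsRing G K 2 c) {x : V}
    (hx : x ∈ K) : EdgeWienerCacti.distSum G K x = 0 := by
  obtain ⟨c', h', rfl⟩ := h.rotate hx
  simp [EdgeWienerCacti.distSum, h'.edgesIn_two]

lemma IsRing.wienerSum_two {K : Finset V} {c : ℕ → V} (h : IsRing G K 2 c) :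
    wienerSum G K = 0 := by
  simp [wienerSum, h.edgesIn_two]

lemma IsRing.wienerSum {K : Finset V} {r : ℕ} {c : ℕ → V} (h : IsRing G K r c) (hr : 3 ≤ r) :
    wienerSum G K = r * ringTransmission r := by
  have gap : ∀ i j, i < j → j < r →
      edgeGap G s(c i, c (next r i)) s(c j, c (next r j)) + 1 = min (j - i) (r - (j - i)) := by
    intro i j hij hj
    have hi : next r i = i + 1 := if_pos (by omega)
    rw [hi, edgeGap_mk, edgeVertexDist_mk, edgeVertexDist_mk, h.2.2 i j hij.le hj,
      h.2.2 (i + 1) j hij hj]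
    rcases Nat.lt_or_ge (j + 1) r with hj' | hj'
    · rw [show next r j = j + 1 from if_pos hj', h.2.2 i (j + 1) (by omega) hj',
        h.2.2 (i + 1) (j + 1) (by omega) hj']
      omega
    · rw [show next r j = 0 from if_neg (by omega), G.dist_comm, h.2.2 0 i (by omega) (by omega),
        G.dist_comm (u := c (i + 1)), h.2.2 0 (i + 1) (by omega) (by omega)]
      omega
  have key : ∀ i < r, ∀ j < r,
      (if s(c i, c (next r i)) = s(c j, c (next r j)) then 0
        else edgeGap G s(c i, c (next r i)) s(c j, c (next r j)) + 1) =
      min (i - j + (j - i)) (r - (i - j + (j - i))) := by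
    intro i hi j hj
    rcases Nat.lt_trichotomy i j with hij | rfl | hij
    · rw [if_neg fun he => hij.ne (h.edge_injOn hr (by simpa using hi) (by simpa using hj) he),
        gap i j hij hj, Nat.sub_eq_zero_of_le hij.le, zero_add]
    · simp
    · rw [if_neg fun he => hij.ne' (h.edge_injOn hr (by simpa using hi) (by simpa using hj) he),
        edgeGap_comm, gap j i hij hi, Nat.sub_eq_zero_of_le hij.le, add_zero]
  have row : ∀ i < r, (∑ j ∈ range r, min (i - j + (j - i)) (r - (i - j + (j - i)))) =
      ringTransmission r := by
    intro i hi
    -- going round the cycle from `i`, the index `j` is met after `j - i` or `r + j - i` steps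
    refine sum_nbij' (fun j => if i ≤ j then j - i else r + j - i)
      (fun a => if a + i < r then a + i else a + i - r) ?_ ?_ ?_ ?_ ?_
    · intro j hj
      rw [mem_range] at hj ⊢
      split_ifs <;> omega
    · intro a ha
      rw [mem_range] at ha ⊢
      split_ifs <;> omega
    · intro j hj
      rw [mem_range] at hj
      rcases le_or_gt i j with hij | hij
      · simp only [if_pos hij]
        rw [if_pos (by omega)]; omega
      · simp only [if_neg (show ¬ i ≤ j by omega)]
        rw [if_neg (by omega)]; omega
    · intro a ha
      rw [mem_range] at ha
      rcases lt_or_ge (a + i) r with hai | hai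
      · simp only [if_pos hai]
        rw [if_pos (by omega)]; omega
      · simp only [if_neg (show ¬ a + i < r by omega)]
        rw [if_neg (by omega)]; omega
    · intro j hj
      rw [mem_range] at hj
      rcases le_or_gt i j with hij | hij
      · rw [if_pos hij, Nat.sub_eq_zero_of_le hij, zero_add]
      · rw [if_neg (by omega), Nat.sub_eq_zero_of_le hij.le, add_zero, min_comm]
        congr 1 <;> omega
  rw [EdgeWienerCacti.wienerSum, h.edgesIn, sum_image (h.edge_injOn hr)]
  rw [sum_congr rfl (fun i hi => by
    rw [sum_image (h.edge_injOn hr), sum_congr rfl (fun j hj =>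
      key i (mem_range.1 hi) j (mem_range.1 hj)), row i (mem_range.1 hi)])]
  rw [sum_const, card_range, smul_eq_mul]

lemma ringDist_add_two (r : ℕ) : ringDist (r + 2) = ringDist r + r := by
  rw [ringDist, sum_range_succ, sum_range_succ', ringDist,
    sum_congr rfl (g := fun i => min i (r - 1 - i) + 1) (fun i hi => by
      rw [mem_range] at hi; omega), sum_add_distrib]
  simp

lemma ringTransmission_add_two (r : ℕ) :
    ringTransmission (r + 2) = ringTransmission r + r + 1 := by
  rw [ringTransmission, sum_range_succ', ringTransmission,
    sum_congr rfl (g := fun i => min i (r - i) + 1) (fun i hi => by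
      rw [mem_range] at hi; omega), sum_add_distrib, sum_range_succ]
  simp
  ring

lemma four_mul_ringDist_le (r : ℕ) : 4 * (ringDist r : ℤ) ≤ ((r : ℤ) - 1) ^ 2 := by
  induction r using Nat.twoStepInduction with
  | zero => simp [ringDist]
  | one => simp [ringDist]
  | more r ih _ => rw [ringDist_add_two]; push_cast; linarith

lemma four_mul_ringTransmission_le (r : ℕ) : 4 * (ringTransmission r : ℤ) ≤ (r : ℤ) ^ 2 := by
  induction r using Nat.twoStepInduction with
  | zero => simp [ringTransmission]
  | one => simp [ringTransmission]
  | more r ih _ => rw [ringTransmission_add_two]; push_cast; linarith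

/-! ### Cacti, built block by block -/

/-- What a block with `r` vertices adds to `P = n - t - 1`, the largest diameter of a cactus with `n`
vertices and `t` cycles. A block with two vertices is a bridge. -/
def lengthGain (r : ℕ) : ℕ := if r = 2 then 1 else r - 2

/-- What a block with `r` vertices adds to the number of cycles. -/
def cycleGain (r : ℕ) : ℕ := if r = 2 then 0 else 1

/-- `A` is built up from a single vertex by gluing on bridges and cycles one by one, at single
vertices. It has `t` cycles and `P + t + 1` vertices. The parameter `P` is the largest diameter that
a cactus with these numbers of cycles and vertices can have, not the diameter of `A`. -/
inductive Built (G : SimpleGraph V) : Finset V → ℕ → ℕ → Prop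
  | single (v : V) : Built G {v} 0 0
  | glue {A K : Finset V} {P t r : ℕ} {x : V} {c : ℕ → V} (hA : Built G A P t)
      (h : Glue G A x K) (hK : IsRing G K r c) :
      Built G (A ∪ K) (P + lengthGain r) (t + cycleGain r)

lemma Built.card_eq (hG : G.Connected) {A : Finset V} {P t : ℕ} (h : Built G A P t) :
    #A = P + t + 1 := by
  induction h with
  | single v => simp
  | @glue A K P t r x c hA h hK ih =>
    have h1 := card_union_of_glue hG h
    have h2 := hK.1
    rw [hK.card] at h1
    unfold lengthGain cycleGain
    split_ifs <;> omega

lemma IsRing.card_edgesIn' {K : Finset V} {r : ℕ} {c : ℕ → V} (h : IsRing G K r c) :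
    #(EdgeWienerCacti.edgesIn G K) = lengthGain r + 2 * cycleGain r := by
  have h2 := h.1
  unfold lengthGain cycleGain
  split_ifs with hr
  · subst hr; rw [h.card_edgesIn_two]
  · rw [h.card_edgesIn (by omega)]; omega

lemma edgesIn_singleton (v : V) : edgesIn G {v} = ∅ := by
  ext e
  induction e using Sym2.ind with | _ a b =>
  simp only [mem_edgesIn, mem_singleton, notMem_empty, iff_false]
  rintro ⟨h, rfl, rfl⟩
  exact h.ne rfl

lemma Built.card_edgesIn (hG : G.Connected) {A : Finset V} {P t : ℕ} (h : Built G A P t) :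
    #(edgesIn G A) = P + 2 * t := by
  induction h with
  | single v => simp [edgesIn_singleton]
  | @glue A K P t r x c hA h hK ih => rw [card_edgesIn_union hG h, ih, hK.card_edgesIn']; ring

lemma Built.cycles_le {A : Finset V} {P t : ℕ} (h : Built G A P t) : t ≤ P := by
  induction h with
  | single v => simp
  | @glue A K P t r x c hA h hK ih =>
    have := hK.1
    unfold lengthGain cycleGain
    split_ifs <;> omega

/-- `K` is an end block of `A`, attached at `x` to the rest `B`, which has parameters `P` and `t`. -/
def EndBlock (G : SimpleGraph V) (A B : Finset V) (P t : ℕ) (x : V) (K : Finset V) (r : ℕ) : Prop :=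
  Built G B P t ∧ Glue G B x K ∧ (∃ c, IsRing G K r c) ∧ A = B ∪ K

/-- Every vertex survives the removal of a suitable end block. -/
lemma Built.exists_endBlock {A : Finset V} {P t : ℕ} (h : Built G A P t) {u : V} (hu : u ∈ A) :
    (A = {u} ∧ P = 0 ∧ t = 0) ∨ ∃ B P' t' x K r, EndBlock G A B P' t' x K r ∧ u ∈ B ∧
      P = P' + lengthGain r ∧ t = t' + cycleGain r := by
  induction h generalizing u with
  | single v => simp at hu; simp [hu]
  | @glue A K P t r x c hA h hK ih =>
    right
    by_cases huA : u ∈ A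
    · exact ⟨A, P, t, x, K, r, ⟨hA, h, ⟨c, hK⟩, rfl⟩, huA, rfl, rfl⟩
    have huK : u ∈ K := (mem_union.1 hu).resolve_left huA
    rcases ih h.1 with ⟨rfl, rfl, rfl⟩ | ⟨B, P', t', y, L, r', ⟨hB, hg, ⟨c', hL⟩, rfl⟩, hxB, rfl, rfl⟩
    · -- the block `K` is all there is: attach it at `u` instead
      refine ⟨{u}, 0, 0, u, K, r, ⟨.single u, ⟨by simp, huK, ?_⟩, ⟨c, hK⟩, ?_⟩, by simp, rfl, rfl⟩
      · intro a ha b hb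
        rw [mem_singleton.1 ha, SimpleGraph.dist_self, zero_add]
      · rw [union_eq_right.2 (by simpa using h.2.1), union_eq_right.2 (by simpa using huK)]
    · obtain ⟨h1, h2⟩ := hg.comm h hxB
      exact ⟨B ∪ K, _, _, y, L, r', ⟨hB.glue h1 hK, h2, ⟨c', hL⟩, by
        rw [union_assoc, union_comm L, union_assoc]⟩, mem_union_right _ huK, by ring, by ring⟩

lemma EndBlock.card_lt (hG : G.Connected) {A B : Finset V} {P t r : ℕ} {x : V} {K : Finset V}
    (h : EndBlock G A B P t x K r) : #B < #A := by
  obtain ⟨-, hg, ⟨c, hK⟩, rfl⟩ := h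
  have := card_union_of_glue hG hg
  have := hK.card
  have := hK.1
  omega

/-- An end block of the rest of `A`, after removal of an end block attached away from it, is an
end block of `A`. -/
lemma EndBlock.swap {A B C : Finset V} {P t P' t' r r' : ℕ} {x y : V} {K L : Finset V}
    (h : EndBlock G A B P t x K r) (h' : EndBlock G B C P' t' y L r') (hx : x ∈ C) :
    EndBlock G A (C ∪ K) (P' + lengthGain r) (t' + cycleGain r) y L r' ∧
      EndBlock G (C ∪ K) C P' t' x K r := by
  obtain ⟨hB, hg, ⟨c, hK⟩, rfl⟩ := h
  obtain ⟨hC, hg', ⟨c', hL⟩, rfl⟩ := h'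
  obtain ⟨h1, h2⟩ := hg'.comm hg hx
  exact ⟨⟨hC.glue h1 hK, h2, ⟨c', hL⟩, by rw [union_assoc, union_comm L, union_assoc]⟩,
    hC, h1, ⟨c, hK⟩, rfl⟩

/-! ### Extremal distances in a cactus -/

lemma IsRing.distSum_eq {K : Finset V} {r : ℕ} {c : ℕ → V} (h : IsRing G K r c) {x : V}
    (hx : x ∈ K) : EdgeWienerCacti.distSum G K x = ringDist r := by
  rcases h.1.eq_or_lt with rfl | hr
  · rw [h.distSum_two hx]; rfl
  · exact h.distSum hr hx

lemma Built.unique (hG : G.Connected) {A : Finset V} {P t P' t' : ℕ} (h : Built G A P t)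
    (h' : Built G A P' t') : P = P' ∧ t = t' := by
  have h1 := h.card_eq hG
  have h2 := h'.card_eq hG
  have h3 := h.card_edgesIn hG
  have h4 := h'.card_edgesIn hG
  omega

lemma EndBlock.built {A B : Finset V} {P t r : ℕ} {x : V} {K : Finset V}
    (h : EndBlock G A B P t x K r) : Built G A (P + lengthGain r) (t + cycleGain r) := by
  obtain ⟨hB, hg, ⟨c, hK⟩, rfl⟩ := h
  exact hB.glue hg hK

lemma lengthGain_two : lengthGain 2 = 1 := rfl

lemma cycleGain_two : cycleGain 2 = 0 := rfl

lemma lengthGain_add_three (s : ℕ) : lengthGain (s + 3) = s + 1 := by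
  rw [lengthGain, if_neg (by omega)]; omega

lemma cycleGain_add_three (s : ℕ) : cycleGain (s + 3) = 1 := by
  rw [cycleGain, if_neg (by omega)]

lemma IsRing.eq_two_or {K : Finset V} {r : ℕ} {c : ℕ → V} (h : IsRing G K r c) :
    r = 2 ∨ ∃ s, r = s + 3 := by
  have := h.1
  rcases this.eq_or_lt with h | h
  · exact .inl h.symm
  · exact .inr ⟨r - 3, by omega⟩

/-- Three vertices of a cactus span perimeter at most `2 P + 1`: only a triangle can separate all
three of them without loss. -/
lemma Built.dist_triple_le {A : Finset V} {P t : ℕ} (h : Built G A P t) {a b c : V}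
    (ha : a ∈ A) (hb : b ∈ A) (hc : c ∈ A) :
    G.dist a b + G.dist a c + G.dist b c ≤ 2 * P + 1 := by
  induction h generalizing a b c with
  | single v => simp_all
  | @glue A K P t r x f hA h hK ih =>
    have gain : (r = 2 ∧ lengthGain r = 1) ∨ (3 ≤ r ∧ lengthGain r + 2 = r) := by
      rcases hK.eq_two_or with rfl | ⟨s, rfl⟩
      · exact .inl ⟨rfl, rfl⟩
      · exact .inr ⟨by omega, by rw [lengthGain_add_three]⟩
    have two : ∀ {a b c}, a ∈ A → b ∈ A → c ∈ K →
        G.dist a b + G.dist a c + G.dist b c ≤ 2 * (P + lengthGain r) + 1 := by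
      intro a b c ha hb hc
      have h1 := ih ha hb h.1
      have h2 := hK.two_mul_dist_le h.2.1 hc
      rw [h.2.2 a ha c hc, h.2.2 b hb c hc]
      omega
    have one : ∀ {a b c}, a ∈ A → b ∈ K → c ∈ K →
        G.dist a b + G.dist a c + G.dist b c ≤ 2 * (P + lengthGain r) + 1 := by
      intro a b c ha hb hc
      have h1 := ih ha h.1 h.1
      have h2 := hK.dist_triple_le h.2.1 hb hc
      rw [SimpleGraph.dist_self] at h1
      rw [h.2.2 a ha b hb, h.2.2 a ha c hc]
      omega
    have e1 := G.dist_comm (u := a) (v := b)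
    have e2 := G.dist_comm (u := a) (v := c)
    have e3 := G.dist_comm (u := b) (v := c)
    rcases mem_union.1 ha with ha | ha <;> rcases mem_union.1 hb with hb | hb <;>
      rcases mem_union.1 hc with hc | hc
    · have := ih ha hb hc; omega
    · exact two ha hb hc
    · have := two ha hc hb; omega
    · exact one ha hb hc
    · have := two hb hc ha; omega
    · have := one hb ha hc; omega
    · have := one hc ha hb; omega
    · have := hK.dist_triple_le ha hb hc; omega

lemma Built.dist_le {A : Finset V} {P t : ℕ} (h : Built G A P t) {a b : V}
    (ha : a ∈ A) (hb : b ∈ A) : G.dist a b ≤ P := by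
  have := h.dist_triple_le ha hb hb
  rw [SimpleGraph.dist_self] at this
  omega

lemma ringDist_three : ringDist 3 = 1 := by decide

lemma four_mul_ringDist_add_three_le (s : ℕ) : 4 * (ringDist (s + 3) : ℤ) ≤ ((s : ℤ) + 2) ^ 2 := by
  have := four_mul_ringDist_le (s + 3)
  push_cast at this
  linarith [show ((s : ℤ) + 3 - 1) ^ 2 = (s + 2) ^ 2 by ring]

/-- The distance sum of a vertex is largest at the end of a path that continues into a chain of
triangles. In the case of equality the vertex is an end of a diameter of length `P`. -/
lemma Built.distSum_le (hG : G.Connected) {A : Finset V} {P t : ℕ} (h : Built G A P t) {u : V}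
    (hu : u ∈ A) :
    2 * (distSum G A u : ℤ) + P + 2 * t ^ 2 ≤ P ^ 2 + 4 * P * t ∧
      (2 * (distSum G A u : ℤ) + P + 2 * t ^ 2 = P ^ 2 + 4 * P * t → ∃ z ∈ A, G.dist u z = P) := by
  induction hn : #A using Nat.strong_induction_on generalizing A P t with | _ n ih =>
  subst hn
  rcases h.exists_endBlock hu with ⟨rfl, rfl, rfl⟩ | ⟨B, P, t, x, K, r, hE, huB, rfl, rfl⟩
  · simp [distSum, edgesIn_singleton]
  have hB := ih _ (hE.card_lt hG) hE.1 huB rfl |>.1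
  have hd : (G.dist u x : ℤ) ≤ P := by exact_mod_cast hE.1.dist_le huB hE.2.1.1
  obtain ⟨-, hg, ⟨c, hK⟩, rfl⟩ := hE
  have hD := distSum_union hG hg huB
  rw [hK.card_edgesIn', hK.distSum_eq hg.2.1] at hD
  have hdist : G.dist u x = P → lengthGain r = 1 →
      ∃ z ∈ B ∪ K, G.dist u z = P + lengthGain r := by
    intro h1 h2
    obtain ⟨c', hK', hx⟩ := hK.rotate hg.2.1
    have h3 := hK.1
    refine ⟨c' 1, mem_union_right _ (hK'.mem (by omega)), ?_⟩
    have := hK'.2.2 0 1 (by omega) (by omega)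
    rw [hg.2.2 u huB _ (hK'.mem (by omega)), h1, h2, ← hx, this]
    omega
  rcases hK.eq_two_or with rfl | ⟨s, rfl⟩
  · rw [lengthGain_two, cycleGain_two] at *
    rw [hD]
    simp only [ringDist, sum_range_succ, sum_range_zero]
    push_cast
    have ht : (0 : ℤ) ≤ t := by positivity
    norm_num
    constructor
    · nlinarith
    · intro h
      have : (G.dist u x : ℤ) = P := by nlinarith
      simpa [lengthGain_two] using hdist (by exact_mod_cast this) rfl
  · rw [lengthGain_add_three, cycleGain_add_three] at *
    rw [hD]
    have hS := four_mul_ringDist_add_three_le s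
    have ht : (0 : ℤ) ≤ t := by positivity
    have hP : (0 : ℤ) ≤ P := by positivity
    have hs : (0 : ℤ) ≤ s := by positivity
    have hsd := mul_le_mul_of_nonneg_left hd hs
    rcases Nat.eq_zero_or_pos s with rfl | hs1
    · norm_num [ringDist_three]
      constructor
      · nlinarith
      · intro h
        have : (G.dist u x : ℤ) = P := by nlinarith
        simpa using hdist (by exact_mod_cast this) rfl
    · have hs1 : (1 : ℤ) ≤ s := by exact_mod_cast hs1
      have : 2 * ((distSum G B u : ℤ) + (s + 3) * G.dist u x + ringDist (s + 3)) +
          (P + s + 1) + 2 * (t + 1) ^ 2 < (P + s + 1) ^ 2 + 4 * (P + s + 1) * (t + 1) := by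
        nlinarith
      push_cast
      constructor
      · linarith
      · intro h
        exfalso
        linarith

/-- If no end block away from `w₁` and `w₂` is attached farther from them than they are from each
other, then the distance sums of `w₁` and `w₂` add up to at most what they are when all blocks are
bridges and triangles strung together between `w₁` and `w₂`. -/
lemma Built.distSum_add_distSum_le (hG : G.Connected) {A : Finset V} {P t : ℕ} (h : Built G A P t)
    {w₁ w₂ : V} (h₁ : w₁ ∈ A) (h₂ : w₂ ∈ A)
    (H : ∀ B P' t' x K r, EndBlock G A B P' t' x K r → w₁ ∈ B → w₂ ∈ B →
      G.dist w₁ x ≤ G.dist w₁ w₂ ∧ G.dist w₂ x ≤ G.dist w₁ w₂) :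
    (distSum G A w₁ : ℤ) + distSum G A w₂ + 2 * G.dist w₁ w₂ + (P + 2 * t) ≤
      (P + 2 * t) * P + 2 * t + 2 * P := by
  induction hn : #A using Nat.strong_induction_on generalizing A P t w₂ with | _ n ih =>
  subst hn
  by_cases hoff : ∃ B P' t' x K r, EndBlock G A B P' t' x K r ∧ w₁ ∈ B ∧ w₂ ∈ B
  · obtain ⟨B, P', t', x, K, r, hE, hB₁, hB₂⟩ := hoff
    obtain ⟨rfl, rfl⟩ := h.unique hG hE.built
    have hd := H _ _ _ _ _ _ hE hB₁ hB₂
    have hIH := ih _ (hE.card_lt hG) hE.1 hB₁ hB₂ (fun C P'' t'' y L r' hE' hC₁ hC₂ => by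
      by_cases hx : x ∈ C
      · exact H _ _ _ _ _ _ (hE.swap hE' hx).1 (mem_union_left _ hC₁) (mem_union_left _ hC₂)
      · have hxL : x ∈ L := (mem_union.1 (hE'.2.2.2 ▸ hE.2.1.1)).resolve_left hx
        have e₁ := hE'.2.1.2.2 _ hC₁ x hxL
        have e₂ := hE'.2.1.2.2 _ hC₂ x hxL
        omega) rfl
    have h3 := hE.1.dist_triple_le hB₁ hB₂ hE.2.1.1
    have h4 : 3 * ((G.dist w₁ x : ℤ) + G.dist w₂ x) ≤ 4 * P' + 2 := by omega
    obtain ⟨-, hg, ⟨c, hK⟩, rfl⟩ := hE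
    have hD₁ := distSum_union hG hg hB₁
    have hD₂ := distSum_union hG hg hB₂
    rw [hK.card_edgesIn', hK.distSum_eq hg.2.1] at hD₁ hD₂
    rw [hD₁, hD₂]
    have ht : (0 : ℤ) ≤ t' := by positivity
    have hP : (0 : ℤ) ≤ P' := by positivity
    rcases hK.eq_two_or with rfl | ⟨s, rfl⟩
    · rw [lengthGain_two, cycleGain_two]
      simp only [ringDist, sum_range_succ, sum_range_zero]
      push_cast
      norm_num
      nlinarith
    · rw [lengthGain_add_three, cycleGain_add_three]
      have hS := four_mul_ringDist_add_three_le s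
      have hs : (0 : ℤ) ≤ s := by positivity
      have hsd := mul_le_mul_of_nonneg_left h4 hs
      push_cast
      nlinarith [mul_nonneg hs hP, mul_nonneg hs ht]
  · -- every end block contains `w₁` or `w₂` in its interior
    push Not at hoff
    rcases h.exists_endBlock h₁ with ⟨rfl, rfl, rfl⟩ | ⟨B, P, t, x, K, r, hE, hB₁, rfl, rfl⟩
    · rw [mem_singleton.1 h₂]
      simp [distSum, edgesIn_singleton]
    have hB₂ := hoff _ _ _ _ _ _ hE hB₁
    have hK₂ : w₂ ∈ K := (mem_union.1 (hE.2.2.2 ▸ h₂)).resolve_left hB₂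
    have hIH := ih _ (hE.card_lt hG) hE.1 hB₁ hE.2.1.1
      (fun C P'' t'' y L r' hE' hC₁ hxC => absurd (mem_union_right _ hK₂)
        (hoff _ _ _ _ _ _ (hE.swap hE' hxC).1 (mem_union_left _ hC₁))) rfl
    have hd : (G.dist w₁ x : ℤ) ≤ P := by exact_mod_cast hE.1.dist_le hB₁ hE.2.1.1
    have hm := hE.1.card_edgesIn hG
    obtain ⟨-, hg, ⟨c, hK⟩, rfl⟩ := hE
    have hD₁ := distSum_union hG hg hB₁
    have hD₂ := distSum_union hG hg.symm hK₂
    have hj := hK.two_mul_dist_le hg.2.1 hK₂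
    rw [hK.card_edgesIn', hK.distSum_eq hg.2.1] at hD₁
    rw [union_comm, hK.distSum_eq hK₂, hm, G.dist_comm] at hD₂
    rw [hD₁, hD₂, hg.2.2 _ hB₁ _ hK₂]
    have ht : (0 : ℤ) ≤ t := by positivity
    have hP : (0 : ℤ) ≤ P := by positivity
    rcases hK.eq_two_or with rfl | ⟨s, rfl⟩
    · rw [lengthGain_two, cycleGain_two]
      have hj : (G.dist x w₂ : ℤ) ≤ 1 := by omega
      simp only [ringDist, sum_range_succ, sum_range_zero]
      push_cast
      norm_num
      nlinarith
    · rw [lengthGain_add_three, cycleGain_add_three]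
      have hj : (G.dist x w₂ : ℤ) ≤ s + 1 := by omega
      have hS := four_mul_ringDist_add_three_le s
      have hs : (0 : ℤ) ≤ s := by positivity
      have hsd := mul_le_mul_of_nonneg_left hd hs
      have hPj := mul_le_mul_of_nonneg_left hj hP
      have htj := mul_le_mul_of_nonneg_left hj ht
      push_cast
      linarith [mul_nonneg hs hP, mul_nonneg hs ht, mul_nonneg hs hs]

/-! ### Strips of bridges and triangles -/

/-- `A` is a chain of bridges and triangles, isometric in `G`: a path `s 0, …, s q` together with a
vertex `τ e` adjacent to `s e` and `s (e + 1)` for every `e ∈ T`. Adjacency is expressed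
through the distances in `G`. -/
structure IsStrip (G : SimpleGraph V) (A : Finset V) (q : ℕ) (T : Finset ℕ) (s τ : ℕ → V) :
    Prop where
  eq : A = (range (q + 1)).image s ∪ T.image τ
  lt : ∀ e ∈ T, e < q
  spine : ∀ x y, x ≤ y → y ≤ q → G.dist (s x) (s y) = y - x
  tip : ∀ x e, x ≤ q → e ∈ T → G.dist (s x) (τ e) = if x ≤ e then e - x + 1 else x - e
  tips : ∀ e f, e ∈ T → f ∈ T → e < f → G.dist (τ e) (τ f) = f - e + 1

namespace IsStrip

variable {A : Finset V} {q : ℕ} {T : Finset ℕ} {s τ : ℕ → V}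

lemma spine_mem (h : IsStrip G A q T s τ) {x : ℕ} (hx : x ≤ q) : s x ∈ A := by
  rw [h.eq]
  exact mem_union_left _ (mem_image_of_mem _ (mem_range.2 (by omega)))

lemma tip_mem (h : IsStrip G A q T s τ) {e : ℕ} (he : e ∈ T) : τ e ∈ A := by
  rw [h.eq]
  exact mem_union_right _ (mem_image_of_mem _ he)

lemma cases (h : IsStrip G A q T s τ) {v : V} (hv : v ∈ A) :
    (∃ x ≤ q, s x = v) ∨ ∃ e ∈ T, τ e = v := by
  rw [h.eq, mem_union, mem_image, mem_image] at hv
  rcases hv with ⟨x, hx, rfl⟩ | hv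
  · exact .inl ⟨x, by rw [mem_range] at hx; omega, rfl⟩
  · exact .inr hv

lemma single (v : V) : IsStrip G {v} 0 ∅ (fun _ => v) (fun _ => v) where
  eq := by ext; simp
  lt := by simp
  spine := by intro x y hx hy; rw [SimpleGraph.dist_self]; omega
  tip := by simp
  tips := by simp

/-- A strip, read from the other end. -/
lemma reverse (h : IsStrip G A q T s τ) :
    IsStrip G A q ((range q).filter fun e => q - 1 - e ∈ T) (fun x => s (q - x))
      (fun e => τ (q - 1 - e)) where
  eq := by
    rw [h.eq]
    congr 1
    · ext v
      simp only [mem_image, mem_range]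
      constructor
      · rintro ⟨x, hx, rfl⟩
        exact ⟨q - x, by omega, by congr 1; omega⟩
      · rintro ⟨x, hx, rfl⟩
        exact ⟨q - x, by omega, rfl⟩
    · ext v
      simp only [mem_image, mem_filter, mem_range]
      constructor
      · rintro ⟨e, he, rfl⟩
        have := h.lt e he
        have e1 : q - 1 - (q - 1 - e) = e := by omega
        exact ⟨q - 1 - e, ⟨by omega, by rwa [e1]⟩, by rw [e1]⟩
      · rintro ⟨e, ⟨-, he⟩, rfl⟩
        exact ⟨_, he, rfl⟩
  lt := by simp +contextual
  spine := by
    intro x y hxy hy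
    rw [G.dist_comm, h.spine _ _ (by omega) (by omega)]
    omega
  tip := by
    intro x e hx he
    simp only [mem_filter, mem_range] at he
    rw [h.tip _ _ (by omega) he.2]
    split_ifs <;> omega
  tips := by
    intro e f he hf hef
    simp only [mem_filter, mem_range] at he hf
    rw [G.dist_comm, h.tips _ _ hf.2 he.2 (by omega)]
    omega

/-- The ends of a strip may be exchanged with the tip of a triangle next to them. -/
lemma swap_left (h : IsStrip G A q T s τ) (h0 : 0 ∈ T) :
    IsStrip G A q T (Function.update s 0 (τ 0)) (Function.update τ 0 (s 0)) where
  eq := by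
    have hq := h.lt 0 h0
    ext v
    constructor
    · intro hv
      rcases h.cases hv with ⟨x, hx, rfl⟩ | ⟨e, he, rfl⟩
      · rcases Nat.eq_zero_or_pos x with rfl | hx0
        · exact mem_union_right _ (mem_image.2 ⟨0, h0, by simp⟩)
        · exact mem_union_left _ (mem_image.2 ⟨x, mem_range.2 (by omega), by
            rw [Function.update_of_ne (by omega)]⟩)
      · rcases Nat.eq_zero_or_pos e with rfl | he0
        · exact mem_union_left _ (mem_image.2 ⟨0, by simp, by simp⟩)
        · exact mem_union_right _ (mem_image.2 ⟨e, he, by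
            rw [Function.update_of_ne (by omega)]⟩)
    · intro hv
      rcases mem_union.1 hv with hv | hv
      · obtain ⟨x, hx, rfl⟩ := mem_image.1 hv
        rw [mem_range] at hx
        rcases Nat.eq_zero_or_pos x with rfl | hx0
        · simpa using h.tip_mem h0
        · rw [Function.update_of_ne (by omega)]
          exact h.spine_mem (by omega)
      · obtain ⟨e, he, rfl⟩ := mem_image.1 hv
        rcases Nat.eq_zero_or_pos e with rfl | he0
        · simpa using h.spine_mem (x := 0) (by omega)
        · rw [Function.update_of_ne (by omega)]
          exact h.tip_mem he
  lt := h.lt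
  spine := by
    intro x y hxy hy
    rcases Nat.eq_zero_or_pos y with rfl | hy0
    · obtain rfl : x = 0 := by omega
      simp
    rw [Function.update_of_ne hy0.ne']
    rcases Nat.eq_zero_or_pos x with rfl | hx0
    · rw [Function.update_self, G.dist_comm, h.tip _ _ hy h0, if_neg (by omega)]
    · rw [Function.update_of_ne hx0.ne', h.spine _ _ hxy hy]
  tip := by
    intro x e hx he
    have hq := h.lt e he
    rcases Nat.eq_zero_or_pos e with rfl | he0
    · rw [Function.update_self]
      rcases Nat.eq_zero_or_pos x with rfl | hx0
      · rw [Function.update_self, G.dist_comm, h.tip _ _ (by omega) h0]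
      · rw [Function.update_of_ne hx0.ne', G.dist_comm, h.spine _ _ (by omega) hx,
          if_neg (by omega)]
    · rw [Function.update_of_ne he0.ne']
      rcases Nat.eq_zero_or_pos x with rfl | hx0
      · rw [Function.update_self, h.tips _ _ h0 he he0]
        simp
      · rw [Function.update_of_ne hx0.ne', h.tip _ _ hx he]
  tips := by
    intro e f he hf hef
    have hq := h.lt f hf
    rw [Function.update_of_ne (show f ≠ 0 by omega)]
    rcases Nat.eq_zero_or_pos e with rfl | he0
    · rw [Function.update_self, h.tip _ _ (by omega) hf, if_pos (by omega)]
    · rw [Function.update_of_ne he0.ne', h.tips _ _ he hf hef]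

lemma reverse_reverse_tips (h : IsStrip G A q T s τ) :
    ((range q).filter fun e => q - 1 - e ∈ (range q).filter fun e => q - 1 - e ∈ T) = T := by
  ext e
  simp only [mem_filter, mem_range]
  constructor
  · rintro ⟨h1, -, h2⟩
    rwa [show q - 1 - (q - 1 - e) = e by omega] at h2
  · intro he
    have := h.lt e he
    exact ⟨this, by omega, by rwa [show q - 1 - (q - 1 - e) = e by omega]⟩

lemma swap_right (h : IsStrip G A q T s τ) {e : ℕ} (hq : q = e + 1) (he : e ∈ T) :
    ∃ s' τ', IsStrip G A q T s' τ' ∧ s' q = τ e ∧ (∀ x < q, s' x = s x) ∧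
      ∀ f < e, τ' f = τ f := by
  have h1 := (h.reverse.swap_left (by simp [hq, he])).reverse
  rw [h.reverse_reverse_tips] at h1
  refine ⟨_, _, h1, ?_, ?_, ?_⟩
  · simp only [Nat.sub_self, Function.update_self]
    congr 1; omega
  · intro x hx
    rw [Function.update_of_ne (by omega)]
    congr 1; omega
  · intro f hf
    rw [Function.update_of_ne (by omega)]
    congr 1; omega

/-- Two vertices at distance `q` in a strip of length `q` are its ends, up to the choice of
coordinates. -/
lemma exists_ends (h : IsStrip G A q T s τ) {v w : V} (hv : v ∈ A) (hw : w ∈ A)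
    (hd : G.dist v w = q) :
    ∃ s' τ', IsStrip G A q T s' τ' ∧ ((s' 0 = v ∧ s' q = w) ∨ (s' 0 = w ∧ s' q = v)) := by
  have mixed : ∀ x e, x ≤ q → e ∈ T → G.dist (s x) (τ e) = q →
      ∃ s' τ', IsStrip G A q T s' τ' ∧
        ((s' 0 = s x ∧ s' q = τ e) ∨ (s' 0 = τ e ∧ s' q = s x)) := by
    intro x e hx he hd
    have hlt := h.lt e he
    rw [h.tip _ _ hx he] at hd
    split_ifs at hd with hxe
    · obtain rfl : x = 0 := by omega
      obtain ⟨s', τ', h', h1, h2, -⟩ := h.swap_right (e := e) (by omega) he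
      exact ⟨s', τ', h', .inl ⟨h2 0 (by omega), h1⟩⟩
    · obtain rfl : x = q := by omega
      obtain rfl : e = 0 := by omega
      exact ⟨_, _, h.swap_left he, .inr ⟨by simp, by rw [Function.update_of_ne (by omega)]⟩⟩
  have far : ∀ e f, e ∈ T → f ∈ T → e < f → G.dist (τ e) (τ f) = q →
      ∃ s' τ', IsStrip G A q T s' τ' ∧ s' 0 = τ e ∧ s' q = τ f := by
    intro e f he hf hef hd
    have hlt := h.lt f hf
    rw [h.tips _ _ he hf hef] at hd
    obtain rfl : e = 0 := by omega
    obtain ⟨s', τ', h', h1, h2, h3⟩ := (h.swap_left he).swap_right (e := f) (by omega) hf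
    refine ⟨s', τ', h', ?_, ?_⟩
    · rw [h2 0 (by omega), Function.update_self]
    · rw [h1, Function.update_of_ne (by omega)]
  rcases h.cases hv with ⟨x, hx, rfl⟩ | ⟨e, he, rfl⟩ <;>
    rcases h.cases hw with ⟨y, hy, rfl⟩ | ⟨f, hf, rfl⟩
  · rcases le_total x y with hxy | hxy
    · rw [h.spine _ _ hxy hy] at hd
      obtain rfl : x = 0 := by omega
      obtain rfl : y = q := by omega
      exact ⟨s, τ, h, .inl ⟨rfl, rfl⟩⟩
    · rw [G.dist_comm, h.spine _ _ hxy hx] at hd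
      obtain rfl : y = 0 := by omega
      obtain rfl : x = q := by omega
      exact ⟨s, τ, h, .inr ⟨rfl, rfl⟩⟩
  · exact mixed x f hx hf hd
  · obtain ⟨s', τ', h', h''⟩ := mixed y e hy he (by rwa [G.dist_comm])
    exact ⟨s', τ', h', h''.symm⟩
  · rcases Nat.lt_trichotomy e f with hef | rfl | hef
    · obtain ⟨s', τ', h', h1, h2⟩ := far e f he hf hef hd
      exact ⟨s', τ', h', .inl ⟨h1, h2⟩⟩
    · rw [SimpleGraph.dist_self] at hd
      have := h.lt e he
      omega
    · obtain ⟨s', τ', h', h1, h2⟩ := far f e hf he hef (by rwa [G.dist_comm])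
      exact ⟨s', τ', h', .inr ⟨h1, h2⟩⟩

lemma add_bridge (h : IsStrip G A q T s τ) {K : Finset V} {c : ℕ → V} (hg : Glue G A (s q) K)
    (hK : IsRing G K 2 c) :
    ∃ s', IsStrip G (A ∪ K) (q + 1) T s' τ ∧ ∀ x ≤ q, s' x = s x := by
  obtain ⟨c, hK, h0⟩ := hK.rotate hg.2.1
  have hv : c 1 ∈ K := hK.mem (by omega)
  have hd : G.dist (s q) (c 1) = 1 := by rw [← h0, hK.2.2 0 1 (by omega) (by omega)]; rfl
  have hgl : ∀ a ∈ A, G.dist a (c 1) = G.dist a (s q) + 1 := fun a ha => by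
    rw [hg.2.2 a ha _ hv, hd]
  refine ⟨fun x => if x ≤ q then s x else c 1, ⟨?_, ?_, ?_, ?_, h.tips⟩, fun x hx => if_pos hx⟩
  · have e1 : (range (q + 1)).image (fun x => if x ≤ q then s x else c 1) =
        (range (q + 1)).image s :=
      image_congr fun x hx => if_pos (by simpa [Nat.lt_succ_iff] using hx)
    rw [range_add_one, image_insert, if_neg (by omega), e1, hK.2.1, h.eq]
    ext v
    have hsq : ∃ a < q + 1, s a = s q := ⟨q, by omega, rfl⟩
    simp only [range_add_one, range_zero, image_insert, image_empty, mem_union, mem_insert,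
      mem_image, mem_range, notMem_empty, h0]
    aesop
  · intro e he
    have := h.lt e he
    omega
  · intro x y hxy hy
    rcases Nat.lt_or_ge q y with hy' | hy'
    · obtain rfl : y = q + 1 := by omega
      simp only [if_neg (show ¬ q + 1 ≤ q by omega)]
      by_cases hx : x ≤ q
      · rw [if_pos hx, hgl _ (h.spine_mem hx), h.spine _ _ hx le_rfl]; omega
      · rw [if_neg hx, SimpleGraph.dist_self]; omega
    · simp only [if_pos hy', if_pos (hxy.trans hy')]
      exact h.spine _ _ hxy hy'
  · intro x e hx he
    have hlt := h.lt e he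
    by_cases hxq : x ≤ q
    · simp only [if_pos hxq]
      exact h.tip _ _ hxq he
    · simp only [if_neg hxq]
      rw [G.dist_comm, hgl _ (h.tip_mem he), G.dist_comm, h.tip _ _ le_rfl he, if_neg (by omega),
        if_neg (by omega)]
      omega

lemma add_triangle (h : IsStrip G A q T s τ) {K : Finset V} {c : ℕ → V} (hg : Glue G A (s q) K)
    (hK : IsRing G K 3 c) :
    ∃ s' τ', IsStrip G (A ∪ K) (q + 1) (insert q T) s' τ' ∧ ∀ x ≤ q, s' x = s x := by
  obtain ⟨c, hK, h0⟩ := hK.rotate hg.2.1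
  have hv : c 1 ∈ K := hK.mem (by omega)
  have hw : c 2 ∈ K := hK.mem (by omega)
  have hd : G.dist (s q) (c 1) = 1 := by rw [← h0, hK.2.2 0 1 (by omega) (by omega)]; rfl
  have hd' : G.dist (s q) (c 2) = 1 := by rw [← h0, hK.2.2 0 2 (by omega) (by omega)]; rfl
  have hd'' : G.dist (c 1) (c 2) = 1 := by rw [hK.2.2 1 2 (by omega) (by omega)]; rfl
  have hgl : ∀ a ∈ A, G.dist a (c 1) = G.dist a (s q) + 1 := fun a ha => by
    rw [hg.2.2 a ha _ hv, hd]
  have hgl' : ∀ a ∈ A, G.dist a (c 2) = G.dist a (s q) + 1 := fun a ha => by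
    rw [hg.2.2 a ha _ hw, hd']
  refine ⟨fun x => if x ≤ q then s x else c 1, fun e => if e < q then τ e else c 2,
    ⟨?_, ?_, ?_, ?_, ?_⟩, fun x hx => if_pos hx⟩
  · have e1 : (range (q + 1)).image (fun x => if x ≤ q then s x else c 1) =
        (range (q + 1)).image s :=
      image_congr fun x hx => if_pos (by simpa [Nat.lt_succ_iff] using hx)
    have e2 : T.image (fun e => if e < q then τ e else c 2) = T.image τ :=
      image_congr fun e he => if_pos (h.lt e he)
    rw [range_add_one, image_insert, image_insert, if_neg (by omega), if_neg (by omega), e1, e2,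
      hK.2.1, h.eq]
    ext v
    have hsq : ∃ a < q + 1, s a = s q := ⟨q, by omega, rfl⟩
    simp only [show range 3 = {0, 1, 2} from rfl, image_insert, image_singleton, mem_union,
      mem_insert, mem_image, mem_range, mem_singleton, h0]
    aesop
  · intro e he
    rcases mem_insert.1 he with rfl | he
    · omega
    · have := h.lt e he
      omega
  · intro x y hxy hy
    rcases Nat.lt_or_ge q y with hy' | hy'
    · obtain rfl : y = q + 1 := by omega
      simp only [if_neg (show ¬ q + 1 ≤ q by omega)]
      by_cases hx : x ≤ q
      · rw [if_pos hx, hgl _ (h.spine_mem hx), h.spine _ _ hx le_rfl]; omega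
      · rw [if_neg hx, SimpleGraph.dist_self]; omega
    · simp only [if_pos hy', if_pos (hxy.trans hy')]
      exact h.spine _ _ hxy hy'
  · intro x e hx he
    rcases mem_insert.1 he with rfl | he
    · simp only [if_neg (lt_irrefl e)]
      by_cases hxq : x ≤ e
      · simp only [if_pos hxq]
        rw [hgl' _ (h.spine_mem hxq), h.spine _ _ hxq le_rfl]
      · simp only [if_neg hxq]
        rw [hd'']; omega
    have hlt := h.lt e he
    simp only [if_pos hlt]
    by_cases hxq : x ≤ q
    · simp only [if_pos hxq]
      exact h.tip _ _ hxq he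
    · simp only [if_neg hxq]
      rw [G.dist_comm, hgl _ (h.tip_mem he), G.dist_comm, h.tip _ _ le_rfl he, if_neg (by omega),
        if_neg (by omega)]
      omega
  · intro e f he hf hef
    have heq : e ∈ T ∧ e < q := by
      rcases mem_insert.1 he with rfl | he
      · rcases mem_insert.1 hf with rfl | hf
        · omega
        · have := h.lt f hf; omega
      · exact ⟨he, h.lt e he⟩
    simp only [if_pos heq.2]
    rcases mem_insert.1 hf with rfl | hf
    · rw [if_neg (lt_irrefl f), hgl' _ (h.tip_mem heq.1), G.dist_comm, h.tip _ _ le_rfl heq.1,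
        if_neg (by omega)]
    · rw [if_pos (h.lt f hf), h.tips _ _ heq.1 hf hef]

/-- A strip arises by gluing a last bridge or triangle to a shorter strip. -/
lemma exists_last (h : IsStrip G A (q + 1) T s τ) :
    ∃ B K c, A = B ∪ K ∧ IsStrip G B q (T.erase q) s τ ∧ Glue G B (s q) K ∧
      IsRing G K (if q ∈ T then 3 else 2) c ∧ s (q + 1) ∈ K := by
  have hB : IsStrip G ((range (q + 1)).image s ∪ (T.erase q).image τ) q (T.erase q) s τ := by
    refine ⟨rfl, ?_, fun x y hxy hy => h.spine x y hxy (by omega), fun x e hx he =>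
      h.tip x e (by omega) (mem_of_mem_erase he), fun e f he hf hef =>
      h.tips e f (mem_of_mem_erase he) (mem_of_mem_erase hf) hef⟩
    intro e he
    have := h.lt e (mem_of_mem_erase he)
    have := ne_of_mem_erase he
    omega
  have toNext : ∀ a ∈ (range (q + 1)).image s ∪ (T.erase q).image τ,
      G.dist a (s (q + 1)) = G.dist a (s q) + 1 := by
    intro a ha
    rcases hB.cases ha with ⟨x, hx, rfl⟩ | ⟨e, he, rfl⟩
    · rw [h.spine _ _ (by omega) le_rfl, h.spine _ _ hx (by omega)]; omega
    · have hlt := hB.lt e he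
      rw [G.dist_comm, h.tip _ _ le_rfl (mem_of_mem_erase he), G.dist_comm,
        h.tip _ _ (by omega) (mem_of_mem_erase he), if_neg (by omega), if_neg (by omega)]
      omega
  have hone : G.dist (s q) (s (q + 1)) = 1 := by rw [h.spine _ _ (by omega) le_rfl]; omega
  by_cases hq : q ∈ T
  · have toTip : ∀ a ∈ (range (q + 1)).image s ∪ (T.erase q).image τ,
        G.dist a (τ q) = G.dist a (s q) + 1 := by
      intro a ha
      rcases hB.cases ha with ⟨x, hx, rfl⟩ | ⟨e, he, rfl⟩
      · rw [h.tip _ _ (by omega) hq, h.spine _ _ hx (by omega), if_pos hx]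
      · have hlt := hB.lt e he
        rw [h.tips _ _ (mem_of_mem_erase he) hq hlt, G.dist_comm,
          h.tip _ _ (by omega) (mem_of_mem_erase he), if_neg (by omega)]
    have htip : G.dist (s q) (τ q) = 1 := by rw [h.tip _ _ (by omega) hq]; simp
    have hside : G.dist (s (q + 1)) (τ q) = 1 := by rw [h.tip _ _ le_rfl hq]; simp
    refine ⟨_, {s q, s (q + 1), τ q}, fun i => if i = 0 then s q else if i = 1 then s (q + 1)
      else τ q, ?_, hB, ⟨hB.spine_mem le_rfl, by simp, ?_⟩, ?_, by simp⟩
    · rw [h.eq]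
      nth_rewrite 1 [← insert_erase hq]
      rw [range_add_one (n := q + 1), image_insert, image_insert]
      ext v
      have hsq : ∃ a < q + 1, s a = s q := ⟨q, by omega, rfl⟩
      simp only [mem_union, mem_insert, mem_image, mem_range, mem_singleton]
      aesop
    · intro a ha b hb
      simp only [mem_insert, mem_singleton] at hb
      rcases hb with rfl | rfl | rfl
      · simp
      · rw [toNext a ha, hone]
      · rw [toTip a ha, htip]
    · rw [if_pos hq]
      refine ⟨by omega, ?_, ?_⟩
      · rw [show range 3 = {0, 1, 2} from rfl]
        simp
      · intro i j hij hj
        interval_cases j <;> interval_cases i <;> simp [hone, htip, hside]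
  · refine ⟨_, {s q, s (q + 1)}, fun i => if i = 0 then s q else s (q + 1), ?_, hB,
      ⟨hB.spine_mem le_rfl, by simp, ?_⟩, ?_, by simp⟩
    · rw [h.eq, erase_eq_of_notMem hq, range_add_one (n := q + 1), image_insert]
      ext v
      have hsq : ∃ a < q + 1, s a = s q := ⟨q, by omega, rfl⟩
      simp only [mem_union, mem_insert, mem_image, mem_range, mem_singleton]
      aesop
    · intro a ha b hb
      simp only [mem_insert, mem_singleton] at hb
      rcases hb with rfl | rfl
      · simp
      · rw [toNext a ha, hone]
    · rw [if_neg hq]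
      refine ⟨by omega, ?_, ?_⟩
      · rw [show range 2 = {0, 1} from rfl]
        simp
      · intro i j hij hj
        interval_cases j <;> interval_cases i <;> simp [hone]

end IsStrip

/-! ### Saw graphs as strips -/

/-- The positions of the triangles in a chain of `i` triangles, `l` bridges and `j` triangles. -/
def sawTips (i l j : ℕ) : Finset ℕ := (range (i + l + j)).filter fun e => e < i ∨ i + l ≤ e

/-- `A` is a saw graph `Sw(i, j; l)`, isometric in `G`, whose spine runs from `a` to `b`. -/
def IsSaw (G : SimpleGraph V) (A : Finset V) (i l j : ℕ) (a b : V) : Prop :=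
  ∃ s τ, IsStrip G A (i + l + j) (sawTips i l j) s τ ∧ s 0 = a ∧ s (i + l + j) = b

lemma IsSaw.reverse {A : Finset V} {i l j : ℕ} {a b : V} (h : IsSaw G A i l j a b) :
    IsSaw G A j l i b a := by
  obtain ⟨s, τ, h, rfl, rfl⟩ := h
  have e : j + l + i = i + l + j := by ring
  have eT : sawTips j l i =
      (range (i + l + j)).filter fun e => i + l + j - 1 - e ∈ sawTips i l j := by
    ext e
    simp only [sawTips, mem_filter, mem_range]
    omega
  unfold IsSaw
  rw [e, eT]
  exact ⟨_, _, h.reverse, rfl, by simp⟩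

lemma IsSaw.add_triangle {A K : Finset V} {i l j : ℕ} {a b : V} {c : ℕ → V}
    (h : IsSaw G A i l j a b) (hg : Glue G A b K) (hK : IsRing G K 3 c) :
    ∃ b', IsSaw G (A ∪ K) i l (j + 1) a b' := by
  obtain ⟨s, τ, h, rfl, rfl⟩ := h
  obtain ⟨s', τ', h', hs⟩ := h.add_triangle hg hK
  have eT : sawTips i l (j + 1) = insert (i + l + j) (sawTips i l j) := by
    ext e
    simp only [sawTips, mem_filter, mem_range, mem_insert]
    omega
  refine ⟨s' (i + l + j + 1), s', τ', ?_, hs 0 (by omega), rfl⟩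
  rw [eT]
  exact h'

lemma IsSaw.add_bridge {A K : Finset V} {i l : ℕ} {a b : V} {c : ℕ → V}
    (h : IsSaw G A i l 0 a b) (hg : Glue G A b K) (hK : IsRing G K 2 c) :
    ∃ b', IsSaw G (A ∪ K) i (l + 1) 0 a b' := by
  obtain ⟨s, τ, h, rfl, rfl⟩ := h
  obtain ⟨s', h', hs⟩ := h.add_bridge hg hK
  have eT : sawTips i (l + 1) 0 = sawTips i l 0 := by
    ext e
    simp only [sawTips, mem_filter, mem_range]
    omega
  refine ⟨s' (i + l + 0 + 1), s', τ, ?_, hs 0 (by omega), rfl⟩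
  rw [eT]
  exact h'

lemma IsSaw.single (v : V) : IsSaw G {v} 0 0 0 v v :=
  ⟨_, _, IsStrip.single v, rfl, rfl⟩

/-- A single triangle belongs to the left chain as well as to the right one. -/
lemma IsSaw.zero_zero_one {A : Finset V} {a b : V} (h : IsSaw G A 0 0 1 a b) :
    IsSaw G A 1 0 0 a b := by
  obtain ⟨s, τ, h, rfl, rfl⟩ := h
  have eT : sawTips 0 0 1 = sawTips 1 0 0 := by decide
  exact ⟨s, τ, eT ▸ h, rfl, rfl⟩

/-- Two vertices at the largest possible distance in a saw graph can be taken as its ends. -/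
lemma IsSaw.exists_ends {A : Finset V} {i l j : ℕ} {a b : V} (h : IsSaw G A i l j a b) {v w : V}
    (hv : v ∈ A) (hw : w ∈ A) (hd : G.dist v w = i + l + j) :
    IsSaw G A i l j v w ∨ IsSaw G A j l i v w := by
  obtain ⟨s, τ, h, -⟩ := h
  obtain ⟨s', τ', h', h0 | h0⟩ := h.exists_ends hv hw hd
  · exact .inl ⟨s', τ', h', h0⟩
  · exact .inr (IsSaw.reverse ⟨s', τ', h', h0⟩)

lemma ringTransmission_three : ringTransmission 3 = 2 := by decide

/-- The number of edges, the distance sum of the last spine vertex, and the Wiener sum of a saw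
graph. -/
lemma IsStrip.saw_values (hG : G.Connected) {A : Finset V} {i l j : ℕ} {s τ : ℕ → V}
    (h : IsStrip G A (i + l + j) (sawTips i l j) s τ) :
    #(edgesIn G A) = 3 * i + l + 3 * j ∧
    2 * (distSum G A (s (i + l + j)) : ℤ) =
      3 * i ^ 2 - i + 6 * i * l + l ^ 2 - l + 2 * (3 * i + l) * j + 3 * j ^ 2 - j ∧
    3 * (wienerSum G A : ℤ) = 9 * i ^ 3 + 18 * i ^ 2 - 9 * i + 9 * i ^ 2 * l + 6 * i * l +
      9 * i * l ^ 2 + l ^ 3 - l +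
      3 * (3 * (3 * i ^ 2 - i + 6 * i * l + l ^ 2 - l) + 15 * i + 5 * l - 3) * j +
      3 * (9 * i + 3 * l + 6) * j ^ 2 + 9 * j ^ 3 := by
  -- the effect of a last triangle and of a last bridge
  have triangle : ∀ {A : Finset V} {q : ℕ} {T : Finset ℕ}, IsStrip G A (q + 1) T s τ → q ∈ T →
      ∃ B, IsStrip G B q (T.erase q) s τ ∧ #(edgesIn G A) = #(edgesIn G B) + 3 ∧
        distSum G A (s (q + 1)) = distSum G B (s q) + #(edgesIn G B) + 1 ∧
        wienerSum G A = wienerSum G B + 6 +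
          2 * (3 * distSum G B (s q) + 4 * #(edgesIn G B)) := by
    intro A q T h hq
    have hone : G.dist (s (q + 1)) (s q) = 1 := by
      rw [G.dist_comm, h.spine _ _ (by omega) le_rfl]; omega
    obtain ⟨B, K, c, rfl, hB, hg, hK, hs⟩ := h.exists_last
    rw [if_pos hq] at hK
    refine ⟨B, hB, ?_, ?_, ?_⟩
    · rw [card_edgesIn_union hG hg, hK.card_edgesIn le_rfl]
    · rw [union_comm, distSum_union hG hg.symm hs, hK.distSum_eq hs, hone, ringDist_three]
      ring
    · rw [wienerSum_union hG hg, hK.wienerSum le_rfl, hK.distSum_eq hg.2.1,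
        hK.card_edgesIn le_rfl, ringDist_three, ringTransmission_three]
      ring
  have bridge : ∀ {A : Finset V} {q : ℕ} {T : Finset ℕ}, IsStrip G A (q + 1) T s τ → q ∉ T →
      ∃ B, IsStrip G B q T s τ ∧ #(edgesIn G A) = #(edgesIn G B) + 1 ∧
        distSum G A (s (q + 1)) = distSum G B (s q) + #(edgesIn G B) ∧
        wienerSum G A = wienerSum G B + 2 * (distSum G B (s q) + #(edgesIn G B)) := by
    intro A q T h hq
    have hone : G.dist (s (q + 1)) (s q) = 1 := by
      rw [G.dist_comm, h.spine _ _ (by omega) le_rfl]; omega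
    obtain ⟨B, K, c, rfl, hB, hg, hK, hs⟩ := h.exists_last
    rw [if_neg hq] at hK
    rw [erase_eq_of_notMem hq] at hB
    refine ⟨B, hB, ?_, ?_, ?_⟩
    · rw [card_edgesIn_union hG hg, hK.card_edgesIn_two]
    · rw [union_comm, distSum_union hG hg.symm hs, hK.distSum_two hs, hone]
      ring
    · rw [wienerSum_union hG hg, hK.wienerSum_two, hK.distSum_two hg.2.1, hK.card_edgesIn_two]
      ring
  induction j generalizing A with
  | succ j ih =>
    have hq : i + l + j ∈ sawTips i l (j + 1) := by simp [sawTips]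
    have eT : (sawTips i l (j + 1)).erase (i + l + j) = sawTips i l j := by
      ext e
      simp only [sawTips, mem_filter, mem_range, mem_erase]
      omega
    obtain ⟨B, hB, h1, h2, h3⟩ := triangle (q := i + l + j) h hq
    rw [eT] at hB
    obtain ⟨e1, e2, e3⟩ := ih hB
    refine ⟨by omega, ?_, ?_⟩
    · rw [← add_assoc, h2, e1]
      push_cast
      linarith
    · rw [h3, e1]
      push_cast
      linarith
  | zero =>
    induction l generalizing A with
    | succ l ih =>
      have hq : i + l ∉ sawTips i (l + 1) 0 := by simp [sawTips]
      have eT : sawTips i (l + 1) 0 = sawTips i l 0 := by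
        ext e
        simp only [sawTips, mem_filter, mem_range]
        omega
      obtain ⟨B, hB, h1, h2, h3⟩ := bridge (q := i + l) h hq
      rw [eT] at hB
      obtain ⟨e1, e2, e3⟩ := ih hB
      simp only [add_zero] at e2
      refine ⟨by omega, ?_, ?_⟩
      · rw [add_zero, ← add_assoc, h2, e1]
        push_cast at e2 ⊢
        linarith
      · rw [h3, e1]
        push_cast at e2 e3 ⊢
        linarith
    | zero =>
      induction i generalizing A with
      | succ i ih =>
        have hq : i ∈ sawTips (i + 1) 0 0 := by simp [sawTips]
        have eT : (sawTips (i + 1) 0 0).erase i = sawTips i 0 0 := by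
          ext e
          simp only [sawTips, mem_filter, mem_range, mem_erase]
          omega
        obtain ⟨B, hB, h1, h2, h3⟩ := triangle (q := i) h hq
        rw [eT] at hB
        obtain ⟨e1, e2, e3⟩ := ih hB
        simp only [add_zero] at e2
        refine ⟨by omega, ?_, ?_⟩
        · rw [add_zero, add_zero, h2, e1]
          push_cast at e2 ⊢
          linarith
        · rw [h3, e1]
          push_cast at e2 e3 ⊢
          linarith
      | zero =>
        have hA : A = {s 0} := by
          rw [h.eq]; ext v; simp [sawTips]
        subst hA
        simp [edgesIn_singleton, distSum, wienerSum]

/-! ### Strips and `sawGraph` -/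

lemma IsStrip.nonempty_iso {i l j : ℕ} {s τ : ℕ → V}
    (h : IsStrip G univ (i + l + j) (sawTips i l j) s τ) : Nonempty (G ≃g sawGraph i j l) := by
  have hL : ∀ a : Fin i, (a : ℕ) ∈ sawTips i l j := fun a => by
    have := a.2; simp only [sawTips, mem_filter, mem_range]; omega
  have hR : ∀ b : Fin j, i + l + (b : ℕ) ∈ sawTips i l j := fun b => by
    have := b.2; simp only [sawTips, mem_filter, mem_range]; omega
  let f : Fin (i + l + j + 1) ⊕ (Fin i ⊕ Fin j) → V :=
    Sum.elim (fun x => s x) (Sum.elim (fun a => τ a) (fun b => τ (i + l + b)))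
  have ss : ∀ x y : ℕ, x ≤ i + l + j → y ≤ i + l + j →
      G.dist (s x) (s y) = x - y + (y - x) := by
    intro x y hx hy
    rcases le_total x y with hxy | hxy
    · rw [h.spine _ _ hxy hy]; omega
    · rw [G.dist_comm, h.spine _ _ hxy hx]; omega
  have tt : ∀ e g, e ∈ sawTips i l j → g ∈ sawTips i l j →
      (e = g ∧ G.dist (τ e) (τ g) = 0) ∨ (e ≠ g ∧ 2 ≤ G.dist (τ e) (τ g)) := by
    intro e g he hg
    rcases Nat.lt_trichotomy e g with heg | rfl | heg
    · rw [h.tips _ _ he hg heg]; omega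
    · simp
    · rw [G.dist_comm, h.tips _ _ hg he heg]; omega
  have st : ∀ x e, x ≤ i + l + j → e ∈ sawTips i l j → 1 ≤ G.dist (s x) (τ e) ∧
      (G.dist (s x) (τ e) = 1 ↔ x = e ∨ x = e + 1) := by
    intro x e hx he
    rw [h.tip _ _ hx he]
    split_ifs <;> omega
  have inj : Function.Injective f := by
    intro u v huv
    have hd : G.dist (f u) (f v) = 0 := by rw [huv, SimpleGraph.dist_self]
    rcases u with x | a | b <;> rcases v with y | a' | b' <;>
      simp only [f, Sum.elim_inl, Sum.elim_inr] at hd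
    · rw [ss _ _ (by omega) (by omega)] at hd
      congr 1; ext; omega
    · have := (st x a' (by omega) (hL a')).1; omega
    · have := (st x _ (by omega) (hR b')).1; omega
    · rw [G.dist_comm] at hd; have := (st y a (by omega) (hL a)).1; omega
    · have := tt _ _ (hL a) (hL a')
      congr 2; ext; omega
    · have := tt _ _ (hL a) (hR b'); omega
    · rw [G.dist_comm] at hd; have := (st y _ (by omega) (hR b)).1; omega
    · have := tt _ _ (hR b) (hL a'); omega
    · have := tt _ _ (hR b) (hR b')
      congr 2; ext; omega
  have surj : Function.Surjective f := by
    intro v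
    rcases h.cases (mem_univ v) with ⟨x, hx, rfl⟩ | ⟨e, he, rfl⟩
    · exact ⟨.inl ⟨x, by omega⟩, rfl⟩
    · simp only [sawTips, mem_filter, mem_range] at he
      by_cases hei : e < i
      · exact ⟨.inr (.inl ⟨e, hei⟩), rfl⟩
      · refine ⟨.inr (.inr ⟨e - (i + l), by omega⟩), ?_⟩
        simp only [f, Sum.elim_inr]
        congr 1; omega
  have adj : ∀ u v, G.Adj (f u) (f v) ↔ (sawGraph i j l).Adj u v := by
    intro u v
    rw [← SimpleGraph.dist_eq_one_iff_adj, sawGraph, SimpleGraph.fromRel_adj]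
    rcases u with x | a | b <;> rcases v with y | a' | b' <;>
      simp only [f, Sum.elim_inl, Sum.elim_inr, sawRel, ne_eq, Sum.inl.injEq, Sum.inr.injEq,
        reduceCtorEq, not_false_eq_true, true_and, or_false, false_or, and_false, iff_false]
    · rw [ss _ _ (by omega) (by omega), Fin.ext_iff]; omega
    · exact (st x a' (by omega) (hL a')).2
    · exact (st x _ (by omega) (hR b')).2
    · rw [G.dist_comm]; exact (st y a (by omega) (hL a)).2
    · have := tt _ _ (hL a) (hL a'); omega
    · have := tt _ _ (hL a) (hR b'); omega
    · rw [G.dist_comm]; exact (st y _ (by omega) (hR b)).2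
    · have := tt _ _ (hR b) (hL a'); omega
    · have := tt _ _ (hR b) (hR b'); omega
  exact ⟨(⟨Equiv.ofBijective f ⟨inj, surj⟩, fun {u v} => adj u v⟩ : sawGraph i j l ≃g G).symm⟩

/-- A function that grows by at most one along each edge bounds distances from below. -/
lemma le_add_dist (hG : G.Connected) {φ : V → ℕ} (hφ : ∀ u v, G.Adj u v → φ v ≤ φ u + 1)
    (u v : V) : φ v ≤ φ u + G.dist u v := by
  obtain ⟨p, hp⟩ := hG.exists_walk_length_eq_dist u v
  rw [← hp]
  clear hp
  induction p with
  | nil => simp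
  | cons hadj p ih =>
    have := hφ _ _ hadj
    rw [SimpleGraph.Walk.length_cons]
    omega

lemma dist_le_succ_of_adj (hG : G.Connected) {u v : V} (h : G.Adj u v) (w : V) :
    G.dist w v ≤ G.dist w u + 1 := by
  have := hG.dist_triangle (u := w) (v := u) (w := v)
  rwa [SimpleGraph.dist_eq_one_iff_adj.2 h] at this

/-- The coordinates of a saw graph make it a strip. -/
lemma exists_isStrip_of_iso (hG : G.Connected) {i l j : ℕ} (f : sawGraph i j l ≃g G) :
    ∃ s τ, IsStrip G univ (i + l + j) (sawTips i l j) s τ := by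
  let q := i + l + j
  let s : ℕ → V := fun x => f (.inl ⟨min x q, by omega⟩)
  let τ : ℕ → V := fun e => if h : e < i then f (.inr (.inl ⟨e, h⟩))
    else if h : e - (i + l) < j then f (.inr (.inr ⟨e - (i + l), h⟩)) else s 0
  have hs : ∀ x : Fin (q + 1), f (.inl x) = s x := fun x => by
    simp only [s]; congr 2; ext; simp only; have := x.2; omega
  have hτL : ∀ a : Fin i, f (.inr (.inl a)) = τ a := fun a => by
    simp only [τ]; rw [dif_pos a.2]
  have hτR : ∀ b : Fin j, f (.inr (.inr b)) = τ (i + l + b) := fun b => by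
    simp only [τ]
    rw [dif_neg (by omega), dif_pos (by have := b.2; omega)]
    congr 3; ext; simp only; omega
  have mem : ∀ e, e ∈ sawTips i l j ↔ e < i ∨ ∃ b < j, e = i + l + b := by
    intro e
    simp only [sawTips, mem_filter, mem_range]
    constructor
    · rintro ⟨h1, h2 | h2⟩
      · exact .inl h2
      · exact .inr ⟨e - (i + l), by omega, by omega⟩
    · rintro (h | ⟨b, hb, rfl⟩) <;> omega
  have adj_succ : ∀ x, x < q → G.Adj (s x) (s (x + 1)) := by
    intro x hx
    rw [f.map_adj_iff, sawGraph, SimpleGraph.fromRel_adj]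
    simp only [sawRel, ne_eq, Sum.inl.injEq, Fin.mk.injEq]
    omega
  have adj_tip : ∀ e ∈ sawTips i l j, G.Adj (s e) (τ e) ∧ G.Adj (s (e + 1)) (τ e) := by
    intro e he
    rcases (mem e).1 he with h | ⟨b, hb, rfl⟩
    · rw [← hτL ⟨e, h⟩, f.map_adj_iff, f.map_adj_iff, sawGraph, SimpleGraph.fromRel_adj,
        SimpleGraph.fromRel_adj]
      simp only [sawRel, ne_eq, reduceCtorEq, not_false_eq_true, true_and, or_false]
      omega
    · rw [← hτR ⟨b, hb⟩, f.map_adj_iff, f.map_adj_iff, sawGraph, SimpleGraph.fromRel_adj,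
        SimpleGraph.fromRel_adj]
      simp only [sawRel, ne_eq, reduceCtorEq, not_false_eq_true, true_and, or_false]
      omega
  -- upper bounds, along the spine
  have up : ∀ x k, x + k ≤ q → G.dist (s x) (s (x + k)) ≤ k := by
    intro x k hk
    induction k with
    | zero => simp
    | succ k ih =>
      have h1 := ih (by omega)
      have h2 := dist_le_succ_of_adj hG (adj_succ (x + k) (by omega)) (s x)
      rw [← add_assoc]
      omega
  have up' : ∀ x y, x ≤ y → y ≤ q → G.dist (s x) (s y) ≤ y - x := by
    intro x y hxy hy
    have := up x (y - x) (by omega)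
    rwa [show x + (y - x) = y by omega] at this
  -- lower bounds, by the position along the spine of the two ends of each edge
  have low : ∀ (φ : ℕ → ℕ) (ψ : ℕ → ℕ), (∀ x, x < q → φ x ≤ φ (x + 1) + 1 ∧ φ (x + 1) ≤ φ x + 1) →
      (∀ e ∈ sawTips i l j, φ e ≤ ψ e + 1 ∧ ψ e ≤ φ e + 1 ∧ φ (e + 1) ≤ ψ e + 1 ∧
        ψ e ≤ φ (e + 1) + 1) →
      ∃ Φ : V → ℕ, (∀ x ≤ q, Φ (s x) = φ x) ∧ (∀ e ∈ sawTips i l j, Φ (τ e) = ψ e) ∧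
        ∀ u v, Φ v ≤ Φ u + G.dist u v := by
    intro φ ψ h1 h2
    let c : Fin (i + l + j + 1) ⊕ (Fin i ⊕ Fin j) → ℕ :=
      Sum.elim (fun x => φ x) (Sum.elim (fun a => ψ a) (fun b => ψ (i + l + b)))
    refine ⟨fun v => c (f.symm v), ?_, ?_, le_add_dist hG ?_⟩
    · intro x hx
      rw [← hs ⟨x, by omega⟩]
      simp [c]
    · intro e he
      rcases (mem e).1 he with h | ⟨b, hb, rfl⟩
      · rw [← hτL ⟨e, h⟩]; simp [c]
      · rw [← hτR ⟨b, hb⟩]; simp [c]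
    · intro u v huv
      have huv := f.symm.map_adj_iff.2 huv
      generalize f.symm u = u at huv ⊢
      generalize f.symm v = v at huv ⊢
      rw [sawGraph, SimpleGraph.fromRel_adj] at huv
      have hL : ∀ a : Fin i, (a : ℕ) ∈ sawTips i l j := fun a => (mem _).2 (.inl a.2)
      have hR : ∀ b : Fin j, i + l + (b : ℕ) ∈ sawTips i l j :=
        fun b => (mem _).2 (.inr ⟨b, b.2, rfl⟩)
      rcases u with x | a | b <;> rcases v with y | a' | b' <;>
        simp only [sawRel, ne_eq, reduceCtorEq, not_false_eq_true, true_and, or_false, false_or,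
          and_false] at huv <;> simp only [c, Sum.elim_inl, Sum.elim_inr]
      · rcases huv.2 with h | h
        · have := h1 x (by omega); rw [h]; omega
        · have := h1 y (by omega); rw [h]; omega
      · have := h2 _ (hL a'); rcases huv with h | h <;> rw [h] <;> omega
      · have := h2 _ (hR b'); rcases huv with h | h <;> rw [h] <;> omega
      · have := h2 _ (hL a); rcases huv with h | h <;> rw [h] <;> omega
      · have := h2 _ (hR b); rcases huv with h | h <;> rw [h] <;> omega
  have lt : ∀ e ∈ sawTips i l j, e < q := fun e he => by
    simp only [sawTips, mem_filter, mem_range] at he; omega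
  refine ⟨s, τ, ?_, lt, ?_, ?_, ?_⟩
  · ext v
    simp only [mem_univ, true_iff, mem_union, mem_image, mem_range]
    obtain ⟨w, rfl⟩ := f.surjective v
    rcases w with x | a | b
    · exact .inl ⟨x, x.2, (hs x).symm⟩
    · exact .inr ⟨a, (mem _).2 (.inl a.2), (hτL a).symm⟩
    · exact .inr ⟨_, (mem _).2 (.inr ⟨b, b.2, rfl⟩), (hτR b).symm⟩
  · intro x y hxy hy
    refine le_antisymm (up' x y hxy hy) ?_
    obtain ⟨Φ, h1, -, h3⟩ := low (fun z => z) (fun e => e) (fun z _ => by omega)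
      (fun e _ => by omega)
    have := h3 (s x) (s y)
    rw [h1 _ hy, h1 _ (hxy.trans hy)] at this
    omega
  · intro x e hx he
    have hlt := lt e he
    obtain ⟨ha, ha'⟩ := adj_tip e he
    refine le_antisymm ?_ ?_
    · split_ifs with hxe
      · have h1 := dist_le_succ_of_adj hG ha (s x)
        have h2 := up' x e hxe (by omega)
        omega
      · have h1 := dist_le_succ_of_adj hG ha' (s x)
        have h2 := up' (e + 1) x (by omega) hx
        rw [G.dist_comm] at h2
        omega
    · obtain ⟨Φ, h1, h2, h3⟩ := low (fun z => z - x + (x - z))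
        (fun g => if x ≤ g then g - x + 1 else x - g) (fun z _ => by omega)
        (fun g _ => by split_ifs <;> omega)
      have := h3 (s x) (τ e)
      rw [h1 _ hx, h2 _ he] at this
      omega
  · intro e g he hg heg
    have hlt := lt g hg
    obtain ⟨-, ha⟩ := adj_tip e he
    obtain ⟨hb, -⟩ := adj_tip g hg
    refine le_antisymm ?_ ?_
    · have h1 := dist_le_succ_of_adj hG hb (τ e)
      have h2 := dist_le_succ_of_adj hG ha (s g)
      have h3 := up' (e + 1) g (by omega) (by omega)
      rw [G.dist_comm] at h3
      rw [G.dist_comm (u := τ e) (v := s g)] at h1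
      omega
    · obtain ⟨Φ, -, h2, h3⟩ := low (fun z => if z ≤ e then e - z + 1 else z - e)
        (fun g => if g = e then 0 else g - e + (e - g) + 1) (fun z _ => by split_ifs <;> omega)
        (fun g _ => by split_ifs <;> omega)
      have := h3 (τ e) (τ g)
      rw [h2 _ he, h2 _ hg, if_pos rfl, if_neg (by omega)] at this
      omega

/-! ### The extremal inequality -/

/-- Six times the largest edge-Wiener index of a cactus with `t` cycles and `P + t + 1` vertices
(other than the cycle of length four). -/
def maxWiener (P t : ℕ) : ℤ :=
  P ^ 3 + 6 * P ^ 2 * t + 3 * P * t ^ 2 - t ^ 3 + 6 * P * t + 12 * t ^ 2 - P - 8 * t -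
    9 * (t % 2 : ℕ) * (P - t)

/-- The conclusion of the induction: either `A` is a cycle of length four, or its Wiener sum is
below the bound, or it attains the bound and `A` is a cycle of length five or a balanced saw. -/
def Bounded (G : SimpleGraph V) (A : Finset V) (P t : ℕ) : Prop :=
  (∃ c, IsRing G A 4 c) ∨ 3 * (wienerSum G A : ℤ) < maxWiener P t ∨
    (3 * (wienerSum G A : ℤ) = maxWiener P t ∧ ((∃ c, IsRing G A 5 c) ∨
      ∃ i l j a b, IsSaw G A i l j a b ∧ t = i + j ∧ P = i + l + j ∧ i ≤ j + 1 ∧ j ≤ i + 1))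

lemma glue_singleton {K : Finset V} {x : V} (hx : x ∈ K) : Glue G {x} x K :=
  ⟨by simp, hx, fun a ha b _ => by
    rw [mem_singleton.1 ha, SimpleGraph.dist_self, zero_add]⟩

lemma IsRing.built {K : Finset V} {r : ℕ} {c : ℕ → V} (h : IsRing G K r c) :
    Built G K (lengthGain r) (cycleGain r) := by
  have h0 : c 0 ∈ K := h.mem (by have := h.1; omega)
  have := (Built.single (c 0)).glue (glue_singleton h0) h
  rwa [union_eq_right.2 (by simpa using h0), zero_add, zero_add] at this

lemma bounded_singleton (u : V) : Bounded G {u} 0 0 := by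
  refine .inr (.inr ⟨by simp [wienerSum, edgesIn_singleton, maxWiener], .inr
    ⟨0, 0, 0, u, u, IsSaw.single u, rfl, rfl, by omega, by omega⟩⟩)

/-- The case of a single block. -/
lemma IsRing.bounded {K : Finset V} {r : ℕ} {c : ℕ → V} (h : IsRing G K r c) :
    Bounded G K (lengthGain r) (cycleGain r) := by
  have h0 : c 0 ∈ K := h.mem (by have := h.1; omega)
  have hu : {c 0} ∪ K = K := union_eq_right.2 (by simpa using h0)
  rcases h.eq_two_or with rfl | ⟨s, rfl⟩
  · obtain ⟨b, hb⟩ := (IsSaw.single (c 0)).add_bridge (glue_singleton h0) h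
    rw [hu] at hb
    exact .inr (.inr ⟨by rw [h.wienerSum_two]; decide, .inr
      ⟨0, 1, 0, _, _, hb, rfl, rfl, by omega, by omega⟩⟩)
  rw [Bounded, h.wienerSum (by omega), lengthGain_add_three, cycleGain_add_three]
  obtain rfl | rfl | rfl | hs : s = 0 ∨ s = 1 ∨ s = 2 ∨ 3 ≤ s := by omega
  · obtain ⟨b, hb⟩ := (IsSaw.single (c 0)).add_triangle (glue_singleton h0) h
    rw [hu] at hb
    exact .inr (.inr ⟨by decide, .inr ⟨0, 0, 1, _, _, hb, rfl, rfl, by omega, by omega⟩⟩)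
  · exact .inl ⟨c, h⟩
  · exact .inr (.inr ⟨by decide, .inl ⟨c, h⟩⟩)
  · refine .inr (.inl ?_)
    have hT := four_mul_ringTransmission_le (s + 3)
    obtain ⟨k, rfl⟩ : ∃ k, s = k + 3 := ⟨s - 3, by omega⟩
    have hk : (0 : ℤ) ≤ k := by positivity
    have hT' := mul_le_mul_of_nonneg_left hT (show (0 : ℤ) ≤ k + 6 by positivity)
    unfold maxWiener
    push_cast at hT' ⊢
    norm_num
    have h2 : 0 ≤ (k : ℤ) * k := by positivity
    have h3 : 0 ≤ (k : ℤ) * k * k := by positivity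
    nlinarith

/-- The case of a pendant edge. Equality is possible only for `t ≤ 1`: the step loses
`9 * (t ^ 2 - t % 2)`. -/
lemma Bounded.add_bridge (hG : G.Connected) {B K : Finset V} {P t : ℕ} {x : V} {c : ℕ → V}
    (hB : Built G B P t) (hb : Bounded G B P t) (hg : Glue G B x K) (hK : IsRing G K 2 c) :
    Bounded G (B ∪ K) (P + 1) t := by
  have hW := wienerSum_union hG hg
  rw [hK.wienerSum_two, hK.card_edgesIn_two, hK.distSum_two hg.2.1, hB.card_edgesIn hG] at hW
  obtain ⟨hD, hDeq⟩ := hB.distSum_le hG hg.1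
  have ho : ((t % 2 : ℕ) : ℤ) ≤ t ^ 2 := by
    have h1 : t % 2 ≤ t := Nat.mod_le _ _
    have h2 : t ≤ t ^ 2 := Nat.le_self_pow (by omega) t
    exact_mod_cast h1.trans h2
  have hmax : maxWiener (P + 1) t = maxWiener P t + 3 * (P ^ 2 + 4 * P * t - P - 2 * t ^ 2) +
      6 * (P + 2 * t) + 9 * (t ^ 2 - (t % 2 : ℕ)) := by
    unfold maxWiener; push_cast; ring
  rcases hb with ⟨f, hf⟩ | hb | ⟨hb, hb'⟩
  · obtain ⟨rfl, rfl⟩ := hB.unique hG hf.built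
    rw [hf.wienerSum (by omega), hf.distSum_eq hg.1, show ringTransmission 4 = 4 by decide,
      show ringDist 4 = 2 by decide] at hW
    refine .inr (.inl ?_)
    rw [hW]
    decide
  · refine .inr (.inl ?_)
    rw [hW, hmax]
    push_cast at ho ⊢
    linarith
  by_cases heq : 3 * (wienerSum G (B ∪ K) : ℤ) = maxWiener (P + 1) t
  swap
  · refine .inr (.inl (lt_of_le_of_ne ?_ heq))
    rw [hW, hmax]
    push_cast at ho ⊢
    linarith
  refine .inr (.inr ⟨heq, .inr ?_⟩)
  rw [hW, hmax] at heq
  push_cast at heq ho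
  have ht : (t : ℤ) ^ 2 = (t : ℤ) % 2 := by linarith
  have hD' : 2 * (distSum G B x : ℤ) + P + 2 * t ^ 2 = P ^ 2 + 4 * P * t := by linarith
  obtain ⟨z, hz, hxz⟩ := hDeq hD'
  have ht1 : t ≤ 1 := by
    have : (t : ℤ) % 2 ≤ 1 := by omega
    have : (t : ℤ) ≤ 1 := by nlinarith
    omega
  rcases hb' with ⟨f, hf⟩ | ⟨i, l, j, a, b, hs, rfl, rfl, h1, h2⟩
  · -- the cycle of length five has too small a distance sum
    obtain ⟨rfl, rfl⟩ := hB.unique hG hf.built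
    rw [hf.distSum_eq hg.1, show ringDist 5 = 4 by decide] at hD'
    simp [lengthGain, cycleGain] at hD'
  -- up to reversal, `x` is the last vertex of the spine
  have hs' : ∃ i' j', i' + j' = i + j ∧ IsSaw G B i' l j' z x := by
    rcases hs.exists_ends hz hg.1 (by rw [G.dist_comm, hxz]) with h | h
    · exact ⟨i, j, rfl, h⟩
    · exact ⟨j, i, add_comm _ _, h⟩
  obtain ⟨i', j', hij, hs'⟩ := hs'
  have hs'' : IsSaw G B (i + j) l 0 z x := by
    obtain ⟨h, h'⟩ | ⟨h, h'⟩ : (j' = 0 ∧ i' = i + j) ∨ (i' = 0 ∧ j' = 1) := by omega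
    · rwa [h, h'] at hs'
    · subst h h'
      obtain rfl | hl : l = 0 ∨ 0 < l := by omega
      · rw [← hij]
        exact hs'.zero_zero_one
      · -- the end at the triangle has too small a distance sum
        exfalso
        obtain ⟨s, τ, hst, -, rfl⟩ := hs'
        have hv := (hst.saw_values hG).2.1
        have hij' : (i : ℤ) + j = 1 := by omega
        have hl' : (0 : ℤ) < l := by exact_mod_cast hl
        push_cast at hD' hv
        rw [show (i : ℤ) + l + j = l + 1 by linarith, hij'] at hD'
        nlinarith
  obtain ⟨b', hb'⟩ := hs''.add_bridge hg hK
  exact ⟨i + j, l + 1, 0, z, b', hb', rfl, by ring, by omega, by omega⟩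

/-- The arithmetic of two end cycles of lengths `a ≥ b ≥ 3`, not both triangles, glued to a cactus
with parameters `P` and `t`, where `a = 3 + y + w`, `b = 3 + y` and `P = t + z`. The parity of `t` is
`o`; the numbers `T` and `S` stand for `ringTransmission` and `ringDist` of the two cycles. The
bound for `D₁ + D₂` is used with weight `b`, and the excess `a - b` is left to the bound for
`D₁`. -/
lemma two_cycles_lt {W D₁ D₂ p T₁ T₂ S₁ S₂ y w z t o : ℤ} (hy : 0 ≤ y) (hw : 0 ≤ w) (hz : 0 ≤ z)
    (ht : 0 ≤ t) (ho' : o ≤ 1) (hyw : 1 ≤ y + w)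
    (hW : W ≤ (t + z) ^ 3 + 6 * (t + z) ^ 2 * t + 3 * (t + z) * t ^ 2 - t ^ 3 + 6 * (t + z) * t +
      12 * t ^ 2 - (t + z) - 8 * t - 9 * o * ((t + z) - t))
    (hQ : D₁ + D₂ + 2 * p + (t + z + 2 * t) ≤ (t + z + 2 * t) * (t + z) + 2 * t + 2 * (t + z))
    (hD : 2 * D₁ + (t + z) + 2 * t ^ 2 ≤ (t + z) ^ 2 + 4 * (t + z) * t) (hp : p ≤ t + z)
    (hT₁ : 4 * T₁ ≤ (3 + y + w) ^ 2) (hT₂ : 4 * T₂ ≤ (3 + y) ^ 2)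
    (hS₁ : 4 * S₁ ≤ (2 + y + w) ^ 2) (hS₂ : 4 * S₂ ≤ (2 + y) ^ 2) :
    W + 3 * ((3 + y + w) * T₁) + 3 * ((3 + y) * T₂) + 6 * ((3 + y + w) * D₁ + (3 + y) * D₂ +
      (3 + y + w) * (3 + y) * p + (t + z + 2 * t) * (S₁ + S₂) + (3 + y) * S₁ + (3 + y + w) * S₂ +
      (t + z + 2 * t) * (6 + 2 * y + w) + (3 + y + w) * (3 + y)) <
    (t + z + 2 + 2 * y + w) ^ 3 + 6 * (t + z + 2 + 2 * y + w) ^ 2 * (t + 2) +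
      3 * (t + z + 2 + 2 * y + w) * (t + 2) ^ 2 - (t + 2) ^ 3 +
      6 * (t + z + 2 + 2 * y + w) * (t + 2) + 12 * (t + 2) ^ 2 - (t + z + 2 + 2 * y + w) -
      8 * (t + 2) - 9 * o * ((t + z + 2 + 2 * y + w) - (t + 2)) := by
  have e1 := mul_le_mul_of_nonneg_left hQ (show 0 ≤ 3 + y by linarith)
  have e2 := mul_le_mul_of_nonneg_left hD hw
  have e3 := mul_le_mul_of_nonneg_left hp
    (show 0 ≤ (3 + y) * (1 + y + w) from mul_nonneg (by linarith) (by linarith))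
  have e4 := mul_le_mul_of_nonneg_left hT₁ (show 0 ≤ 3 + y + w by linarith)
  have e5 := mul_le_mul_of_nonneg_left hT₂ (show 0 ≤ 3 + y by linarith)
  have e6 := mul_le_mul_of_nonneg_left hS₁ (show 0 ≤ t + z + 2 * t + (3 + y) by linarith)
  have e7 := mul_le_mul_of_nonneg_left hS₂ (show 0 ≤ t + z + 2 * t + (3 + y + w) by linarith)
  have e8 := mul_le_mul_of_nonneg_left ho' (show 0 ≤ 72 * y + 36 * w by linarith)
  -- what remains of the difference of the two sides after the estimates above, apart from constants
  -- and terms linear in `y` and `w`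
  have pos : 0 ≤ 72 * (t * t * y) + 36 * (t * t * w) + 48 * (t * y * z) + 84 * (t * y * y) +
      216 * (t * y) + 84 * (t * w * y) + 108 * (t * w) + 18 * (t * w * w) + 12 * (y * y * z) +
      72 * (y * z) + 12 * (w * y * z) + 36 * (w * z) + 6 * (w * w * z) + 14 * (y * y * y) +
      126 * (y * y) + 21 * (w * y * y) + 126 * (w * y) + 9 * (w * w * y) + 27 * (w * w) +
      w * w * w := by positivity
  linarith

/-- The contribution of two end cycles, with all quantities that depend on the rest of the cactus as
variables. Equality holds only for two triangles at the greatest possible distance. -/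
lemma add_cycles_ineq {P t r₁ r₂ : ℕ} (htP : t ≤ P) (hr₂ : 3 ≤ r₂) (hr : r₂ ≤ r₁)
    {W D₁ D₂ p : ℤ} (hW : W ≤ maxWiener P t)
    (hQ : D₁ + D₂ + 2 * p + (P + 2 * t) ≤ (P + 2 * t) * P + 2 * t + 2 * P)
    (hD : 2 * D₁ + P + 2 * t ^ 2 ≤ P ^ 2 + 4 * P * t) (hp : p ≤ P) :
    W + 3 * (r₁ * ringTransmission r₁) + 3 * (r₂ * ringTransmission r₂) +
      6 * (r₁ * D₁ + r₂ * D₂ + r₁ * r₂ * p +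
        (P + 2 * t) * (ringDist r₁ + ringDist r₂) + r₂ * ringDist r₁ + r₁ * ringDist r₂ +
        (P + 2 * t) * (r₁ + r₂) + r₁ * r₂) ≤
        maxWiener (P + lengthGain r₁ + lengthGain r₂) (t + cycleGain r₁ + cycleGain r₂) ∧
    (W + 3 * (r₁ * ringTransmission r₁) + 3 * (r₂ * ringTransmission r₂) +
      6 * (r₁ * D₁ + r₂ * D₂ + r₁ * r₂ * p +
        (P + 2 * t) * (ringDist r₁ + ringDist r₂) + r₂ * ringDist r₁ + r₁ * ringDist r₂ +
        (P + 2 * t) * (r₁ + r₂) + r₁ * r₂) =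
        maxWiener (P + lengthGain r₁ + lengthGain r₂) (t + cycleGain r₁ + cycleGain r₂) →
      r₁ = 3 ∧ r₂ = 3 ∧ W = maxWiener P t ∧ p = P) := by
  obtain ⟨y, rfl⟩ : ∃ y, r₂ = y + 3 := ⟨r₂ - 3, by omega⟩
  obtain ⟨w, rfl⟩ : ∃ w, r₁ = y + w + 3 := ⟨r₁ - (y + 3), by omega⟩
  obtain ⟨z, rfl⟩ : ∃ z, P = t + z := ⟨P - t, by omega⟩
  rw [lengthGain_add_three, lengthGain_add_three, cycleGain_add_three, cycleGain_add_three]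
  have hmod : (t + 1 + 1) % 2 = t % 2 := by omega
  have ho : t % 2 ≤ 1 := by omega
  unfold maxWiener at *
  rw [hmod]
  generalize t % 2 = o at *
  have hT₁ := four_mul_ringTransmission_le (y + w + 3)
  have hT₂ := four_mul_ringTransmission_le (y + 3)
  have hS₁ := four_mul_ringDist_add_three_le (y + w)
  have hS₂ := four_mul_ringDist_add_three_le y
  by_cases hyw : y = 0 ∧ w = 0
  · obtain ⟨rfl, rfl⟩ := hyw
    simp only [Nat.zero_add, ringTransmission_three, ringDist_three]
    push_cast at *
    constructor
    · linarith
    · intro h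
      refine ⟨trivial, trivial, ?_, ?_⟩ <;> linarith
  · push_cast at *
    have hlt := two_cycles_lt (W := W) (D₁ := D₁) (D₂ := D₂) (p := p) (y := y) (w := w) (z := z)
      (t := t) (o := o) (T₁ := ringTransmission (y + w + 3)) (T₂ := ringTransmission (y + 3))
      (S₁ := ringDist (y + w + 3)) (S₂ := ringDist (y + 3)) (by positivity) (by positivity)
      (by positivity) (by positivity) (by exact_mod_cast ho) (by omega) (by linarith)
      (by linarith) (by linarith) hp (by linarith) (by linarith) (by linarith) (by linarith)
    constructor
    · linarith
    · intro h
      exfalso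
      linarith

/-- The case of two end cycles. The hypothesis `H` is what the choice of a pair of end cycles as far
apart as possible provides. -/
lemma Bounded.add_cycles (hG : G.Connected) {A K₁ K₂ : Finset V} {P t r₁ r₂ : ℕ} {w₁ w₂ : V}
    {c₁ c₂ : ℕ → V} (hA : Built G A P t) (hb : Bounded G A P t) (hg₁ : Glue G A w₁ K₁)
    (hg₂ : Glue G (A ∪ K₁) w₂ K₂) (hw₂ : w₂ ∈ A) (hK₁ : IsRing G K₁ r₁ c₁)
    (hK₂ : IsRing G K₂ r₂ c₂) (hr₂ : 3 ≤ r₂) (hr : r₂ ≤ r₁)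
    (H : ∀ B P' t' x K r, EndBlock G A B P' t' x K r → w₁ ∈ B → w₂ ∈ B →
      G.dist w₁ x ≤ G.dist w₁ w₂ ∧ G.dist w₂ x ≤ G.dist w₁ w₂) :
    Bounded G (A ∪ K₁ ∪ K₂) (P + lengthGain r₁ + lengthGain r₂)
      (t + cycleGain r₁ + cycleGain r₂) := by
  have hQ := hA.distSum_add_distSum_le hG hg₁.1 hw₂ H
  have hD := (hA.distSum_le hG hg₁.1).1
  have hp : (G.dist w₁ w₂ : ℤ) ≤ P := by exact_mod_cast hA.dist_le hg₁.1 hw₂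
  have hm := hA.card_edgesIn hG
  have hm' := card_edgesIn_union hG hg₁
  have hW := wienerSum_union hG hg₁
  have hW' := wienerSum_union hG hg₂
  have hD' := distSum_union hG hg₁ hw₂
  rw [hK₁.card_edgesIn (by omega), hm] at hm'
  rw [hK₁.card_edgesIn (by omega), hK₁.wienerSum (by omega), hK₁.distSum_eq hg₁.2.1, hm] at hW
  rw [hK₁.card_edgesIn (by omega), hK₁.distSum_eq hg₁.2.1, G.dist_comm] at hD'
  rw [hK₂.card_edgesIn (by omega), hK₂.wienerSum (by omega), hK₂.distSum_eq hg₂.2.1, hm', hW,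
    hD'] at hW'
  have htP : t ≤ P := hA.cycles_le
  have hWZ : 3 * (wienerSum G (A ∪ K₁ ∪ K₂) : ℤ) = 3 * wienerSum G A +
      3 * (r₁ * ringTransmission r₁) + 3 * (r₂ * ringTransmission r₂) +
      6 * (r₁ * distSum G A w₁ + r₂ * distSum G A w₂ + r₁ * r₂ * G.dist w₁ w₂ +
        (P + 2 * t) * (ringDist r₁ + ringDist r₂) + r₂ * ringDist r₁ + r₁ * ringDist r₂ +
        (P + 2 * t) * (r₁ + r₂) + r₁ * r₂) := by
    rw [hW']; push_cast; ring
  have ineq := fun W D₁ D₂ p => add_cycles_ineq (W := W) (D₁ := D₁) (D₂ := D₂) (p := p) htP hr₂ hr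
  refine .inr ?_
  rcases hb with ⟨f, hf⟩ | hb | ⟨hb, hb'⟩
  · -- The cycle of length four exceeds the bound by one, but its distance sums are too small.
    left
    obtain ⟨rfl, rfl⟩ := hA.unique hG hf.built
    have hp2 := hf.two_mul_dist_le hg₁.1 hw₂
    have hp2 : (G.dist w₁ w₂ : ℤ) ≤ 2 := by omega
    have e1 : (lengthGain 4 : ℤ) = 2 := rfl
    have e2 : (cycleGain 4 : ℤ) = 1 := rfl
    rw [hf.wienerSum (by omega), hf.distSum_eq hg₁.1, hf.distSum_eq hw₂,
      show ringTransmission 4 = 4 by decide, show ringDist 4 = 2 by decide] at hWZ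
    have := (ineq 42 2 4 (G.dist w₁ w₂) (by decide) (by rw [e1, e2]; linarith)
      (by rw [e1, e2]; norm_num) (by rw [e1]; linarith)).1
    have hr₂' : (3 : ℤ) ≤ r₂ := by exact_mod_cast hr₂
    push_cast at hWZ
    linarith
  · left
    rw [hWZ]
    have h := ineq _ _ _ _ hb.le hQ hD hp
    exact lt_of_le_of_ne h.1 fun h' => hb.ne (h.2 h').2.2.1
  · obtain ⟨h1, h2⟩ := ineq _ _ _ _ hb.le hQ hD hp
    rw [hWZ]
    refine (lt_or_eq_of_le h1).imp id fun heq => ⟨heq, .inr ?_⟩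
    obtain ⟨rfl, rfl, -, hpP⟩ := h2 heq
    rcases hb' with ⟨f, hf⟩ | ⟨i, l, j, a, b, hs, rfl, rfl, h1, h2⟩
    · obtain ⟨rfl, rfl⟩ := hA.unique hG hf.built
      have hp2 := hf.two_mul_dist_le hg₁.1 hw₂
      have e1 : (lengthGain 5 : ℤ) = 3 := rfl
      rw [e1] at hpP
      omega
    · have hs' : ∃ i' j', i' + j' = i + j ∧ i' ≤ j' + 1 ∧ j' ≤ i' + 1 ∧
          IsSaw G A i' l j' w₁ w₂ := by
        rcases hs.exists_ends hg₁.1 hw₂ (by exact_mod_cast hpP) with h | h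
        · exact ⟨i, j, rfl, h1, h2, h⟩
        · exact ⟨j, i, add_comm _ _, h2, h1, h⟩
      obtain ⟨i', j', hij, h1', h2', hs'⟩ := hs'
      obtain ⟨hg₂', hg₁'⟩ := hg₁.comm hg₂ hw₂
      obtain ⟨b', hb'⟩ := hs'.add_triangle hg₂' hK₂
      obtain ⟨b'', hb''⟩ := hb'.reverse.add_triangle hg₁' hK₁
      rw [union_right_comm]
      have e1 : lengthGain 3 = 1 := rfl
      have e2 : cycleGain 3 = 1 := rfl
      exact ⟨_, _, _, _, _, hb'', by omega, by omega, by omega, by omega⟩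

/-- The bound for every cactus that is built up block by block. -/
theorem Built.bounded (hG : G.Connected) {A : Finset V} {P t : ℕ} (h : Built G A P t) :
    Bounded G A P t := by
  induction hn : #A using Nat.strong_induction_on generalizing A P t with | _ n ih =>
  subst hn
  by_cases hleaf : ∃ B P' t' x K, EndBlock G A B P' t' x K 2
  · obtain ⟨B, P', t', x, K, hE⟩ := hleaf
    obtain ⟨rfl, rfl⟩ := h.unique hG hE.built
    have := ih _ (hE.card_lt hG) hE.1 rfl
    obtain ⟨hB, hg, ⟨c, hK⟩, rfl⟩ := hE
    exact this.add_bridge hG hB hg hK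
  -- `d` is the distance between the attachment vertices of two end blocks
  let IsGap : ℕ → Prop := fun d => ∃ C P₀ t₀ w₁ K₁ r₁ B P₁ t₁ w₂ K₂ r₂,
    EndBlock G B C P₀ t₀ w₁ K₁ r₁ ∧ EndBlock G A B P₁ t₁ w₂ K₂ r₂ ∧ w₂ ∈ C ∧ G.dist w₁ w₂ = d
  have gap_le : ∀ d, IsGap d → d ≤ P := by
    rintro d ⟨C, P₀, t₀, w₁, K₁, r₁, B, P₁, t₁, w₂, K₂, r₂, h1, h2, hw, rfl⟩
    refine h.dist_le ?_ ?_ <;> rw [h2.2.2.2] <;> refine mem_union_left _ ?_ <;> rw [h1.2.2.2] <;>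
      refine mem_union_left _ ?_
    exacts [h1.2.1.1, hw]
  have hpos : 0 < #A := by have := h.card_eq hG; omega
  obtain ⟨u, hu⟩ := card_pos.1 hpos
  rcases h.exists_endBlock hu with ⟨rfl, rfl, rfl⟩ | ⟨B, P', t', x, K, r, hE, -, rfl, rfl⟩
  · exact bounded_singleton u
  rcases hE.1.exists_endBlock hE.2.1.1 with
    ⟨rfl, rfl, rfl⟩ | ⟨C, P'', t'', y, L, r', hE', hx, -, -⟩
  · obtain ⟨-, hg, ⟨c, hK⟩, rfl⟩ := hE
    rw [union_eq_right.2 (by simpa using hg.2.1), zero_add, zero_add]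
    exact hK.bounded
  -- take the two end blocks as far apart as possible
  have hmax := Nat.findGreatest_spec (P := IsGap)
    (gap_le _ ⟨_, _, _, _, _, _, _, _, _, _, _, _, hE', hE, hx, rfl⟩)
    ⟨_, _, _, _, _, _, _, _, _, _, _, _, hE', hE, hx, rfl⟩
  have hle : ∀ d, IsGap d → d ≤ Nat.findGreatest IsGap (P' + lengthGain r) :=
    fun d hd => Nat.le_findGreatest (gap_le d hd) hd
  obtain ⟨C, P₀, t₀, w₁, K₁, r₁, B, P₁, t₁, w₂, K₂, r₂, h1, h2, hw, hd⟩ := hmax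
  rw [← hd] at hle
  -- an end block of the rest farther from `w₁` or `w₂` would give a pair that is farther apart
  have H : ∀ E P' t' x L r, EndBlock G C E P' t' x L r → w₁ ∈ E → w₂ ∈ E →
      G.dist w₁ x ≤ G.dist w₁ w₂ ∧ G.dist w₂ x ≤ G.dist w₁ w₂ := by
    intro E P' t' x L r hC hw₁ hw₂
    obtain ⟨f1, f2⟩ := h1.swap hC hw₁
    obtain ⟨f3, f4⟩ := h2.swap f1 (mem_union_left _ hw₂)
    have hxE : x ∈ E := hC.2.1.1
    refine ⟨hle _ ?_, hle _ ?_⟩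
    · exact ⟨_, _, _, _, _, _, _, _, _, _, _, _, (f4.swap f2 hw₂).1, f3, mem_union_left _ hxE, rfl⟩
    · exact ⟨_, _, _, _, _, _, _, _, _, _, _, _, f4, f3, mem_union_left _ hxE, rfl⟩
  obtain ⟨g1, g2⟩ := h2.swap h1 hw
  have hr₂ : r₂ ≠ 2 := by
    rintro rfl
    exact hleaf ⟨_, _, _, _, _, h2⟩
  have hr₁ : r₁ ≠ 2 := by
    rintro rfl
    exact hleaf ⟨_, _, _, _, _, g1⟩
  have hC := ih _ ((h1.card_lt hG).trans (h2.card_lt hG)) h1.1 rfl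
  have hbuilt := h2.1.unique hG h1.built
  have hbuilt' := h.unique hG h2.built
  obtain ⟨hCb, hg1, ⟨c₁, hK₁⟩, rfl⟩ := h1
  obtain ⟨-, hg2, ⟨c₂, hK₂⟩, rfl⟩ := h2
  rw [hbuilt'.1, hbuilt'.2, hbuilt.1, hbuilt.2]
  have := hK₁.1
  have := hK₂.1
  rcases le_total r₂ r₁ with hr | hr
  · exact hC.add_cycles hG hCb hg1 hg2 hw hK₁ hK₂ (by omega) hr H
  · have := hC.add_cycles hG hCb g2.2.1 g1.2.1 hg1.1 hK₂ hK₁ (by omega) hr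
      (fun E P' t' x L r hE hw₂ hw₁ => by
        rw [G.dist_comm (u := w₂) (v := w₁)]
        exact (H _ _ _ _ _ _ hE hw₁ hw₂).symm)
    rwa [union_right_comm, add_right_comm P₀, add_right_comm t₀] at this

/-! ### Gates: every cactus is built up block by block -/

/-- The map `σ` records at which vertex `c i` of a bridge or cycle `c 0, …, c (r - 1)` the other
vertices of `G` hang: edges outside the block do not change the value of `σ`. -/
structure IsGate (G : SimpleGraph V) (r : ℕ) (c : ℕ → V) (σ : V → ℕ) : Prop where
  two_le : 2 ≤ r
  lt : ∀ v, σ v < r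
  apply : ∀ i < r, σ (c i) = i
  adj : ∀ i < r, G.Adj (c i) (c (next r i))
  eq_or : ∀ u w, G.Adj u w → σ u = σ w ∨
    (u = c (σ u) ∧ w = c (σ w) ∧ (σ w = next r (σ u) ∨ σ u = next r (σ w)))

/-- A block with a gate lies isometrically in `G`, since `σ` changes by at most one cyclic step along
each edge. -/
lemma IsGate.isRing (hG : G.Connected) {r : ℕ} {c : ℕ → V} {σ : V → ℕ} (h : IsGate G r c σ) :
    IsRing G ((range r).image c) r c := by
  have h2 := h.two_le
  have up : ∀ i k, i + k < r → G.dist (c i) (c (i + k)) ≤ k := by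
    intro i k hk
    induction k with
    | zero => simp
    | succ k ih =>
      have h1 := ih (by omega)
      have hadj := h.adj (i + k) (by omega)
      rw [next, if_pos (by omega)] at hadj
      have h2 := dist_le_succ_of_adj hG hadj (c i)
      rw [← add_assoc]
      omega
  have up' : ∀ i j, i ≤ j → j < r → G.dist (c i) (c j) ≤ j - i := by
    intro i j hij hj
    have := up i (j - i) (by omega)
    rwa [show i + (j - i) = j by omega] at this
  refine ⟨h2, rfl, fun i j hij hj => le_antisymm (le_min (up' i j hij hj) ?_) ?_⟩
  · -- the way round through `c (r - 1)` and `c 0`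
    have h1 := up' 0 i (by omega) (by omega)
    have h3 := up' j (r - 1) (by omega) (by omega)
    have hadj := h.adj (r - 1) (by omega)
    rw [next, if_neg (by omega)] at hadj
    have h4 := dist_le_succ_of_adj hG hadj (c j)
    have h5 := hG.dist_triangle (u := c j) (v := c 0) (w := c i)
    rw [G.dist_comm]
    omega
  · have hL := le_add_dist hG
      (φ := fun v => min (σ v - i + (i - σ v)) (r - (σ v - i + (i - σ v)))) ?_ (c i) (c j)
    · simp only [h.apply i (by omega), h.apply j hj] at hL
      omega
    · intro u v huv
      have hu := h.lt u
      have hv := h.lt v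
      rcases h.eq_or u v huv with he | ⟨-, -, he | he⟩
      · rw [he]; omega
      · unfold next at he; split_ifs at he <;> omega
      · unfold next at he; split_ifs at he <;> omega

/-- `ρ` is a retraction onto `A` which is constant on everything that hangs at a vertex of `A`. -/
structure IsRetraction (A : Finset V) (G : SimpleGraph V) (ρ : V → V) : Prop where
  mem : ∀ v, ρ v ∈ A
  apply : ∀ a ∈ A, ρ a = a
  eq : ∀ u v, u ∉ A → G.Adj u v → ρ v = ρ u

/-- Every path from `v` to `A` enters `A` at `ρ v`. -/
lemma IsRetraction.dist_eq (hG : G.Connected) {A : Finset V} {ρ : V → V}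
    (h : IsRetraction A G ρ) (v : V) {a : V} (ha : a ∈ A) :
    G.dist v a = G.dist v (ρ v) + G.dist (ρ v) a := by
  refine le_antisymm hG.dist_triangle ?_
  obtain ⟨p, hp⟩ := hG.exists_walk_length_eq_dist v a
  rw [← hp]
  clear hp
  induction p with
  | nil => simp [h.apply _ ha]
  | @cons v w a hvw p ih =>
    by_cases hv : v ∈ A
    · rw [h.apply v hv, SimpleGraph.dist_self, zero_add]
      exact G.dist_le _
    · have h1 := ih ha
      rw [h.eq v w hv hvw] at h1
      have h2 := dist_le_succ_of_adj hG hvw.symm (ρ v)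
      rw [G.dist_comm, G.dist_comm (u := ρ v)] at h2
      rw [SimpleGraph.Walk.length_cons]
      omega

/-- A block that hangs at a vertex of `A` is glued to `A`, and the retraction extends. -/
lemma IsRetraction.extend (hG : G.Connected) {A : Finset V} {ρ : V → V} (h : IsRetraction A G ρ)
    {r : ℕ} {c : ℕ → V} {σ : V → ℕ} (hc : IsGate G r c σ) (h0 : c 0 ∈ A)
    (hρ : ∀ i, 0 < i → i < r → c i ∉ A ∧ ρ (c i) = c 0) :
    Glue G A (c 0) ((range r).image c) ∧ ∃ ρ', IsRetraction (A ∪ (range r).image c) G ρ' := by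
  have h2 := hc.two_le
  have mem : ∀ i < r, c i ∈ (range r).image c := fun i hi =>
    mem_image_of_mem _ (mem_range.2 hi)
  have hρ' : ∀ i < r, ρ (c i) = c 0 := by
    intro i hi
    rcases Nat.eq_zero_or_pos i with rfl | hi0
    · exact h.apply _ h0
    · exact (hρ i hi0 hi).2
  constructor
  · refine ⟨h0, mem 0 (by omega), fun a ha b hb => ?_⟩
    obtain ⟨i, hi, rfl⟩ := mem_image.1 hb
    have := h.dist_eq hG (c i) ha
    rw [hρ' i (mem_range.1 hi)] at this
    rw [G.dist_comm, this, G.dist_comm (u := c 0) (v := a), G.dist_comm (u := c 0) (v := c i),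
      add_comm]
  · refine ⟨fun v => if ρ v = c 0 then c (σ v) else ρ v, ?_, ?_, ?_⟩
    · intro v
      split_ifs
      · exact mem_union_right _ (mem _ (hc.lt v))
      · exact mem_union_left _ (h.mem v)
    · intro v hv
      rcases mem_union.1 hv with hv | hv
      · rw [h.apply v hv]
        split_ifs with hv0
        · rw [hv0, hc.apply 0 (by omega)]
        · rfl
      · obtain ⟨i, hi, rfl⟩ := mem_image.1 hv
        have hi := mem_range.1 hi
        rw [if_pos (hρ' i hi), hc.apply i hi]
    · intro u v hu huv
      rw [mem_union, not_or] at hu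
      have hσ : σ u = σ v := (hc.eq_or u v huv).resolve_right fun he =>
        hu.2 (he.1 ▸ mem _ (hc.lt u))
      simp only [h.eq u v hu.1 huv, hσ]

/-- The gate of a bridge tells on which side of the bridge a vertex lies. -/
lemma exists_isGate_of_bridge {x v : V} (hxv : G.Adj x v)
    (hb : ∀ (u : V) (p : G.Walk u u), p.IsCycle → s(x, v) ∉ p.edges) :
    ∃ σ, IsGate G 2 (fun i => if i = 0 then x else v) σ := by
  have hnr : ¬ (G.deleteEdges {s(x, v)}).Reachable x v := fun h => by
    obtain ⟨u, p, hp, he⟩ := adj_and_reachable_delete_edges_iff_exists_cycle.1 ⟨hxv, h⟩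
    exact hb u p hp he
  have hx : ¬ (G.deleteEdges {s(x, v)}).Reachable v x := fun h => hnr h.symm
  have hv : (G.deleteEdges {s(x, v)}).Reachable v v := .refl _
  refine ⟨fun u => if (G.deleteEdges {s(x, v)}).Reachable v u then 1 else 0, le_rfl, ?_, ?_, ?_, ?_⟩
  · intro u; split_ifs <;> omega
  · intro i hi
    interval_cases i <;> simp [hx]
  · intro i hi
    interval_cases i <;> simp [next, hxv, hxv.symm]
  · intro u w huw
    by_cases he : s(u, w) = s(x, v)
    · right
      rcases Sym2.eq_iff.1 he with ⟨rfl, rfl⟩ | ⟨rfl, rfl⟩ <;> simp [hx, next]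
    · left
      have hadj : (G.deleteEdges {s(x, v)}).Adj u w := by
        rw [deleteEdges_adj]; exact ⟨huw, by simpa using he⟩
      have : (G.deleteEdges {s(x, v)}).Reachable v u ↔ (G.deleteEdges {s(x, v)}).Reachable v w :=
        ⟨fun h => h.trans hadj.reachable, fun h => h.trans hadj.symm.reachable⟩
      simp only [this]

/-- In a cactus, different vertices of a cycle are not connected outside the cycle. Otherwise the
two edges of the cycle at `x` could be deleted without separating their ends, and there would be a
second cycle through one of them. -/
lemma not_reachable_of_isCycle
    (hc : (cycles G).Pairwise fun C D => (C.verts ∩ D.verts).Subsingleton) {x y : V}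
    {p : G.Walk x x} (hp : p.IsCycle) (hy : y ∈ p.toSubgraph.verts) (hyx : y ≠ x) :
    ¬ (G.deleteEdges p.toSubgraph.edgeSet).Reachable x y := by
  intro hreach
  have h3 := hp.three_le_length
  have hlast : p.getVert (p.length - 1 + 1) = x := by
    rw [show p.length - 1 + 1 = p.length by omega, p.getVert_length]
  have ne_x : ∀ k, 1 ≤ k → k < p.length → p.getVert k ≠ x := by
    intro k h1 h2 h
    have := (hp.getVert_endpoint_iff h2.le).1 h
    omega
  have hadj : ∀ k < p.length, p.toSubgraph.Adj (p.getVert k) (p.getVert (k + 1)) :=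
    fun k hk => p.toSubgraph_adj_getVert hk
  have a1 := hadj 0 (by omega)
  have a2 := hadj (p.length - 1) (by omega)
  rw [p.getVert_zero] at a1
  rw [hlast] at a2
  -- `a` and `b` are the neighbours of `x` on the cycle
  set a := p.getVert (0 + 1) with ha
  set b := p.getVert (p.length - 1) with hb
  have hab : a ≠ b := fun h => by
    have := hp.getVert_injOn (by simp; omega) (by simp; omega) h
    omega
  let G' := G.deleteEdges {s(b, x)}
  have hGa : G'.Adj x a := by
    rw [deleteEdges_adj]
    refine ⟨a1.adj_sub, ?_⟩
    rw [Set.mem_singleton_iff, Sym2.eq_iff]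
    rintro (⟨h1, h2⟩ | ⟨-, h2⟩)
    · exact a2.adj_sub.ne h1.symm
    · exact hab h2
  have hadj' : ∀ k, 1 ≤ k → k + 1 < p.length →
      (G'.deleteEdges {s(x, a)}).Adj (p.getVert k) (p.getVert (k + 1)) := by
    intro k h1 h2
    rw [deleteEdges_adj, deleteEdges_adj]
    have n1 := ne_x k h1 (by omega)
    have n2 := ne_x (k + 1) (by omega) h2
    refine ⟨⟨(hadj k (by omega)).adj_sub, ?_⟩, ?_⟩ <;>
      rw [Set.mem_singleton_iff, Sym2.eq_iff] <;> tauto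
  have hreach' : ∀ k, 1 ≤ k → k < p.length →
      (G'.deleteEdges {s(x, a)}).Reachable a (p.getVert k) := by
    intro k h1 h2
    induction k, h1 using Nat.le_induction with
    | base => exact .refl _
    | succ k h1 ih => exact (ih (by omega)).trans (hadj' k h1 h2).reachable
  have hxa : (G'.deleteEdges {s(x, a)}).Reachable x a := by
    have hle : G.deleteEdges p.toSubgraph.edgeSet ≤ G'.deleteEdges {s(x, a)} := by
      intro u w huw
      rw [deleteEdges_adj] at huw
      rw [deleteEdges_adj, deleteEdges_adj]
      refine ⟨⟨huw.1, fun h => huw.2 ?_⟩, fun h => huw.2 ?_⟩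
      · rw [Set.mem_singleton_iff.1 h]; exact a2
      · rw [Set.mem_singleton_iff.1 h]; exact a1
    obtain ⟨k, hk, hkl⟩ := p.mem_support_iff_exists_getVert.1 (p.mem_verts_toSubgraph.1 hy)
    have hk0 : k ≠ 0 := fun h => hyx (by rw [← hk, h, p.getVert_zero])
    have hkl' : k ≠ p.length := fun h => hyx (by rw [← hk, h, p.getVert_length])
    have := hreach' k (by omega) (by omega)
    rw [hk] at this
    exact (hreach.mono hle).trans this.symm
  obtain ⟨u, q, hq, he⟩ := adj_and_reachable_delete_edges_iff_exists_cycle.1 ⟨hGa, hxa⟩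
  have hle : G' ≤ G := deleteEdges_le _
  have hq' : (q.mapLe hle).IsCycle := hq.mapLe hle
  have he' : (q.mapLe hle).toSubgraph.Adj x a := by
    rw [Walk.adj_toSubgraph_iff_mem_edges, Walk.edges_mapLe_eq_edges]
    exact he
  have hne : p.toSubgraph ≠ (q.mapLe hle).toSubgraph := by
    intro h
    rw [h, Walk.adj_toSubgraph_iff_mem_edges, Walk.edges_mapLe_eq_edges] at a2
    have := q.adj_of_mem_edges a2
    rw [deleteEdges_adj] at this
    exact this.2 rfl
  exact a1.adj_sub.ne (hc ⟨x, p, hp, rfl⟩ ⟨u, _, hq', rfl⟩ hne ⟨a1.fst_mem, he'.fst_mem⟩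
    ⟨a1.snd_mem, he'.snd_mem⟩)

/-- The gate of a cycle of a cactus: every component that is left when the edges of the cycle are
deleted contains exactly one vertex of the cycle. -/
lemma exists_isGate_of_isCycle (hG : G.Connected)
    (hc : (cycles G).Pairwise fun C D => (C.verts ∩ D.verts).Subsingleton) {x : V}
    {p : G.Walk x x} (hp : p.IsCycle) : ∃ σ, IsGate G p.length p.getVert σ := by
  have h3 := hp.three_le_length
  let H := G.deleteEdges p.toSubgraph.edgeSet
  have inj : ∀ i j, i < p.length → j < p.length → p.getVert i = p.getVert j → i = j :=
    fun i j hi hj h => hp.getVert_injOn' (by simp; omega) (by simp; omega) h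
  have mem : ∀ i, p.getVert i ∈ p.toSubgraph.verts := fun i =>
    p.mem_verts_toSubgraph.2 (p.getVert_mem_support i)
  have uniq : ∀ i j, i < p.length → j < p.length → H.Reachable (p.getVert i) (p.getVert j) →
      i = j := by
    intro i j hi hj h
    by_contra hij
    have hi' := p.getVert_mem_support i
    have key := not_reachable_of_isCycle hc (hp.rotate hi') (y := p.getVert j)
      (by rw [p.toSubgraph_rotate]; exact mem j) (fun h' => hij (inj i j hi hj h'.symm))
    rw [p.toSubgraph_rotate] at key
    exact key h
  have vert : ∀ v ∈ p.toSubgraph.verts, ∃ i < p.length, p.getVert i = v := by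
    intro v hv
    obtain ⟨k, hk, hkl⟩ := p.mem_support_iff_exists_getVert.1 (p.mem_verts_toSubgraph.1 hv)
    rcases hkl.eq_or_lt with rfl | hkl
    · exact ⟨0, by omega, by rw [p.getVert_zero, ← hk, p.getVert_length]⟩
    · exact ⟨k, hkl, hk⟩
  have ex : ∀ v, ∃ i < p.length, H.Reachable v (p.getVert i) := by
    intro v
    obtain ⟨q⟩ := hG.preconnected v (p.getVert 0)
    generalize hz : p.getVert 0 = z at q
    induction q with
    | nil => exact ⟨0, by omega, hz ▸ .refl _⟩
    | @cons v w z hvw q ih =>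
      by_cases he : p.toSubgraph.Adj v w
      · obtain ⟨i, hi, hiv⟩ := vert v he.fst_mem
        exact ⟨i, hi, hiv ▸ .refl _⟩
      · obtain ⟨i, hi, hiv⟩ := ih hz
        have : H.Adj v w := by rw [deleteEdges_adj]; exact ⟨hvw, he⟩
        exact ⟨i, hi, this.reachable.trans hiv⟩
  choose σ hlt hσ using ex
  have happ : ∀ i < p.length, σ (p.getVert i) = i := fun i hi =>
    (uniq _ _ hi (hlt _) (hσ _)).symm
  have hnext : ∀ i < p.length, p.getVert (i + 1) = p.getVert (next p.length i) := by
    intro i hi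
    unfold next
    split_ifs with h
    · rfl
    · rw [show i + 1 = p.length by omega, p.getVert_length, p.getVert_zero]
  have hn : ∀ i, next p.length i < p.length := fun i => next_lt (by omega)
  refine ⟨σ, by omega, hlt, happ, fun i hi => ?_, fun u w huw => ?_⟩
  · rw [← hnext i hi]
    exact p.adj_getVert_succ hi
  · by_cases he : p.toSubgraph.Adj u w
    · right
      obtain ⟨i, hi, hil⟩ := p.toSubgraph_adj_iff.1 he
      rw [hnext i hil] at hi
      rcases Sym2.eq_iff.1 hi with ⟨rfl, rfl⟩ | ⟨rfl, rfl⟩ <;>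
        simp [happ i hil, happ _ (hn i)]
    · left
      have hadj : H.Adj u w := by rw [deleteEdges_adj]; exact ⟨huw, he⟩
      exact uniq _ _ (hlt u) (hlt w) ((hσ u).symm.trans (hadj.reachable.trans (hσ w)))

lemma exists_adj_of_mem_cycles {C : G.Subgraph} (hC : C ∈ cycles G) {u : V} (hu : u ∈ C.verts) :
    ∃ w, C.Adj u w := by
  obtain ⟨x, p, hp, rfl⟩ := hC
  have hu' := p.mem_verts_toSubgraph.1 hu
  have h3 := (hp.rotate hu').three_le_length
  have := (p.rotate u hu').toSubgraph_adj_getVert (i := 0) (by omega)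
  rw [Walk.getVert_zero, p.toSubgraph_rotate] at this
  exact ⟨_, this⟩

/-- One step of the construction of a cactus: the block through an edge that leaves `A` is glued
on. If this edge is a bridge, no cycle is added; otherwise exactly one is. -/
lemma exists_extend (hG : G.Connected)
    (hc : (cycles G).Pairwise fun C D => (C.verts ∩ D.verts).Subsingleton) {A : Finset V} {P : ℕ}
    {ρ : V → V} (hA : Built G A P {C ∈ cycles G | C.verts ⊆ A}.ncard) (h : IsRetraction A G ρ)
    (hne : A ≠ univ) :
    ∃ B P' ρ', #A < #B ∧ Built G B P' {C ∈ cycles G | C.verts ⊆ B}.ncard ∧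
      IsRetraction B G ρ' := by
  obtain ⟨v, hv⟩ : ∃ v, v ∉ A := by simpa [Finset.ext_iff] using hne
  obtain ⟨q⟩ := hG.preconnected (ρ v) v
  obtain ⟨⟨⟨x, v⟩, hxv⟩, -, hx, hv⟩ :=
    q.exists_boundary_dart (A : Set V) (h.mem v) (by simpa using hv)
  simp only [mem_coe] at hx hv hxv
  have hρv : ρ v = x := by rw [← h.eq v x hv hxv.symm, h.apply x hx]
  -- what remains to be done once the block through the edge `xv` has been found
  have finish : ∀ (r : ℕ) (c : ℕ → V) (σ : V → ℕ), IsGate G r c σ → c 0 = x →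
      (∀ i, 0 < i → i < r → c i ∉ A ∧ ρ (c i) = c 0) →
      {C ∈ cycles G | C.verts ⊆ ↑(A ∪ (range r).image c)}.ncard =
        {C ∈ cycles G | C.verts ⊆ A}.ncard + cycleGain r →
      ∃ B P' ρ', #A < #B ∧ Built G B P' {C ∈ cycles G | C.verts ⊆ B}.ncard ∧
        IsRetraction B G ρ' := by
    intro r c σ hσ h0 hρ hn
    obtain ⟨hg, ρ', hρ'⟩ := h.extend hG hσ (h0 ▸ hx) hρ
    refine ⟨_, _, ρ', ?_, hn ▸ hA.glue hg (hσ.isRing hG), hρ'⟩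
    have h2 := hσ.two_le
    refine card_lt_card ⟨subset_union_left, fun hsub => (hρ 1 (by omega) (by omega)).1 ?_⟩
    exact hsub (mem_union_right _ (mem_image_of_mem _ (mem_range.2 (by omega))))
  by_cases hb : ∀ (u : V) (p : G.Walk u u), p.IsCycle → s(x, v) ∉ p.edges
  · obtain ⟨σ, hσ⟩ := exists_isGate_of_bridge hxv hb
    refine finish _ _ σ hσ rfl (fun i hi hi' => ?_) ?_
    · obtain rfl : i = 1 := by omega
      exact ⟨hv, hρv⟩
    · rw [cycleGain_two, add_zero]
      congr 1
      ext C
      refine and_congr_right fun hC => ⟨fun hsub u hu => ?_, fun hsub => hsub.trans (by simp)⟩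
      by_contra huA
      have huv : u = v := by
        have := hsub hu
        simp only [range_add_one, range_zero, coe_union, Set.mem_union, mem_coe] at this
        have := this.resolve_left huA
        simp at this
        rcases this with rfl | rfl
        · rfl
        · exact absurd hx huA
      subst huv
      obtain ⟨w, hw⟩ := exists_adj_of_mem_cycles hC hu
      have hwx : w = x := by
        by_cases hwA : w ∈ A
        · rw [← h.apply w hwA, h.eq u w huA hw.adj_sub, hρv]
        · have := hsub hw.snd_mem
          simp only [range_add_one, range_zero, coe_union, Set.mem_union, mem_coe] at this
          have := this.resolve_left hwA
          simp at this
          rcases this with rfl | rfl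
          · exact absurd rfl hw.adj_sub.ne
          · rfl
      subst hwx
      obtain ⟨y, p, hp, rfl⟩ := hC
      exact hb y p hp (Walk.adj_toSubgraph_iff_mem_edges.1 hw.symm)
  · push Not at hb
    obtain ⟨y, p, hp, he⟩ := hb
    have hxp := p.fst_mem_support_of_mem_edges he
    have hvp := p.snd_mem_support_of_mem_edges he
    rw [← p.mem_verts_toSubgraph, ← p.toSubgraph_rotate hxp] at hvp
    replace hp := hp.rotate hxp
    generalize p.rotate x hxp = p at hp hvp
    obtain ⟨σ, hσ⟩ := exists_isGate_of_isCycle hG hc hp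
    have h3 := hp.three_le_length
    have ne_x : ∀ k, 1 ≤ k → k < p.length → p.getVert k ≠ x := by
      intro k h1 h2 h
      have := (hp.getVert_endpoint_iff h2.le).1 h
      omega
    obtain ⟨j, hj, hjl⟩ := p.mem_support_iff_exists_getVert.1 (p.mem_verts_toSubgraph.1 hvp)
    have hj0 : j ≠ 0 := fun h => hxv.ne (by rw [← hj, h, p.getVert_zero])
    have hjl' : j ≠ p.length := fun h => hxv.ne (by rw [← hj, h, p.getVert_length])
    -- the property of lying outside `A`, in the part hanging at `x`, spreads along the cycle
    have step : ∀ k l, 1 ≤ l → l < p.length → G.Adj (p.getVert k) (p.getVert l) →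
        (p.getVert k ∉ A ∧ ρ (p.getVert k) = x) → p.getVert l ∉ A ∧ ρ (p.getVert l) = x := by
      intro k l h1 h2 hadj hk
      have hρl : ρ (p.getVert l) = x := by rw [h.eq _ _ hk.1 hadj, hk.2]
      refine ⟨fun hl => ne_x l h1 h2 ?_, hρl⟩
      exact (h.apply _ hl).symm.trans hρl
    have hup : ∀ k, j ≤ k → k < p.length → p.getVert k ∉ A ∧ ρ (p.getVert k) = x := by
      intro k hk
      induction k, hk using Nat.le_induction with
      | base => intro _; rw [hj]; exact ⟨hv, hρv⟩
      | succ k hk ih =>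
        intro hkl
        exact step k (k + 1) (by omega) hkl (p.adj_getVert_succ (by omega)) (ih (by omega))
    have hdown : ∀ d, d < j → p.getVert (j - d) ∉ A ∧ ρ (p.getVert (j - d)) = x := by
      intro d
      induction d with
      | zero => intro _; exact hup j le_rfl (by omega)
      | succ d ih =>
        intro hd
        refine step (j - d) (j - (d + 1)) (by omega) (by omega) ?_ (ih (by omega))
        have := p.adj_getVert_succ (i := j - (d + 1)) (by omega)
        rw [show j - (d + 1) + 1 = j - d by omega] at this
        exact this.symm
    have hall : ∀ i, 0 < i → i < p.length → p.getVert i ∉ A ∧ ρ (p.getVert i) = x := by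
      intro i h0 hi
      rcases le_total j i with hji | hij
      · exact hup i hji hi
      · have := hdown (j - i) (by omega)
        rwa [show j - (j - i) = i by omega] at this
    refine finish _ _ σ hσ p.getVert_zero (by rwa [p.getVert_zero]) ?_
    have hverts : p.toSubgraph.verts = ↑((range p.length).image p.getVert) := by
      ext u
      rw [p.mem_verts_toSubgraph, p.mem_support_iff_exists_getVert]
      simp only [coe_image, coe_range, Set.mem_image, Set.mem_Iio]
      constructor
      · rintro ⟨k, hk, hkl⟩
        rcases hkl.eq_or_lt with rfl | hkl
        · exact ⟨0, by omega, by rw [p.getVert_zero, ← hk, p.getVert_length]⟩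
        · exact ⟨k, hkl, hk⟩
      · rintro ⟨k, hk, hkl⟩
        exact ⟨k, hkl, hk.le⟩
    have hset : {C ∈ cycles G | C.verts ⊆ ↑(A ∪ (range p.length).image p.getVert)} =
        insert p.toSubgraph {C ∈ cycles G | C.verts ⊆ A} := by
      ext C
      simp only [Set.mem_ofPred_eq, Set.mem_insert_iff]
      constructor
      · rintro ⟨hC, hsub⟩
        by_cases hCA : C.verts ⊆ A
        · exact .inr ⟨hC, hCA⟩
        left
        obtain ⟨u, hu, huA⟩ := Set.not_subset.1 hCA
        rw [mem_coe] at huA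
        have hup : u ∈ p.toSubgraph.verts := by
          rw [hverts]
          have := hsub hu
          rw [coe_union, Set.mem_union, mem_coe] at this
          exact this.resolve_left huA
        obtain ⟨w, hw⟩ := exists_adj_of_mem_cycles hC hu
        have hwp : w ∈ p.toSubgraph.verts := by
          by_cases hwA : w ∈ A
          · have hρu : ρ u = x := by
              rw [hverts, mem_coe] at hup
              obtain ⟨i, hi, rfl⟩ := mem_image.1 hup
              refine (hall i (Nat.pos_of_ne_zero fun h => huA ?_) (mem_range.1 hi)).2
              rwa [h, p.getVert_zero]
            rw [← h.apply w hwA, h.eq u w huA hw.adj_sub, hρu]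
            exact p.start_mem_verts_toSubgraph
          · rw [hverts]
            have := hsub hw.snd_mem
            rw [coe_union, Set.mem_union, mem_coe] at this
            exact this.resolve_left hwA
        by_contra hne
        exact hw.adj_sub.ne (hc hC ⟨x, p, hp, rfl⟩ hne ⟨hw.fst_mem, hup⟩ ⟨hw.snd_mem, hwp⟩)
      · rintro (rfl | ⟨hC, hCA⟩)
        · refine ⟨⟨x, p, hp, rfl⟩, ?_⟩
          rw [hverts]
          exact mod_cast subset_union_right
        · exact ⟨hC, hCA.trans (mod_cast subset_union_left)⟩
    rw [hset, Set.ncard_insert_of_notMem, cycleGain, if_neg (by omega)]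
    rintro ⟨-, hsub⟩
    refine (hall 1 (by omega) (by omega)).1 (hsub ?_)
    rw [hverts]
    exact mod_cast mem_image_of_mem _ (mem_range.2 (by omega))

/-- Every cactus is built up block by block, with its number of cycles as parameter. -/
theorem IsCactus.exists_built (hG : IsCactus G) : ∃ P, Built G univ P (cycles G).ncard := by
  obtain ⟨hG, hc⟩ := hG
  have key : ∀ n ≤ Fintype.card V, ∃ A P ρ, n ≤ #A ∧
      Built G A P {C ∈ cycles G | C.verts ⊆ A}.ncard ∧ IsRetraction A G ρ := by
    intro n
    induction n with
    | zero =>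
      intro _
      obtain ⟨v⟩ := hG.nonempty
      have hempty : {C ∈ cycles G | C.verts ⊆ ↑({v} : Finset V)} = ∅ := by
        ext C
        simp only [Set.mem_ofPred_eq, Set.mem_empty_iff_false, iff_false, coe_singleton]
        rintro ⟨hC, hsub⟩
        have hC' := hC
        obtain ⟨x, p, -, rfl⟩ := hC'
        obtain ⟨w, hw⟩ := exists_adj_of_mem_cycles hC p.start_mem_verts_toSubgraph
        exact hw.adj_sub.ne ((hsub hw.fst_mem).trans (hsub hw.snd_mem).symm)
      refine ⟨{v}, 0, fun _ => v, by omega, ?_, ⟨by simp, by simp, by simp⟩⟩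
      rw [hempty, Set.ncard_empty]
      exact .single v
    | succ n ih =>
      intro hn
      obtain ⟨A, P, ρ, h1, h2, h3⟩ := ih (by omega)
      by_cases hA : A = univ
      · exact ⟨A, P, ρ, by rwa [hA, card_univ], h2, h3⟩
      · obtain ⟨B, P', ρ', h4, h5, h6⟩ := exists_extend hG hc h2 h3 hA
        exact ⟨B, P', ρ', by omega, h5, h6⟩
  obtain ⟨A, P, ρ, h1, h2, -⟩ := key _ le_rfl
  obtain rfl : A = univ := (card_eq_iff_eq_univ A).1 (le_antisymm (card_le_univ A) h1)
  refine ⟨P, ?_⟩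
  simpa using h2

/-! ### The edge-Wiener index as a sum over ordered pairs of edges -/

lemma exists_walk_lineGraph {e f : G.edgeSet} {v : V} (he : v ∈ (e : Sym2 V))
    (hf : v ∈ (f : Sym2 V)) : ∃ q : G.lineGraph.Walk e f, q.length ≤ 1 := by
  by_cases hef : e = f
  · subst hef
    exact ⟨.nil, by simp⟩
  · exact ⟨.cons (lineGraph_adj_iff_exists.2 ⟨hef, v, he, hf⟩) .nil, by simp⟩

/-- A walk between ends of two edges lifts to a walk in the line graph. -/
lemma exists_walk_lineGraph_of_walk {u v : V} (p : G.Walk u v) (e f : G.edgeSet)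
    (he : u ∈ (e : Sym2 V)) (hf : v ∈ (f : Sym2 V)) :
    ∃ q : G.lineGraph.Walk e f, q.length ≤ p.length + 1 := by
  induction p generalizing e with
  | nil =>
    obtain ⟨q, hq⟩ := exists_walk_lineGraph he hf
    exact ⟨q, by simpa using hq⟩
  | @cons u w v h p ih =>
    obtain ⟨q, hq⟩ := ih ⟨s(u, w), h⟩ (Sym2.mem_mk_right u w) hf
    obtain ⟨q', hq'⟩ := exists_walk_lineGraph (f := ⟨s(u, w), h⟩) he (Sym2.mem_mk_left u w)
    refine ⟨q'.append q, ?_⟩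
    rw [Walk.length_append, Walk.length_cons]
    omega

lemma exists_dist_eq_edgeGap (e f : Sym2 V) : ∃ u ∈ e, ∃ v ∈ f, G.dist u v = edgeGap G e f := by
  induction e using Sym2.ind with | _ a b =>
  induction f using Sym2.ind with | _ x y =>
  simp only [edgeGap_mk, edgeVertexDist_mk, Sym2.mem_iff, exists_eq_or_imp, exists_eq_left]
  omega

lemma edgeGap_le {e f : Sym2 V} {u v : V} (hu : u ∈ e) (hv : v ∈ f) :
    edgeGap G e f ≤ G.dist u v := by
  induction e using Sym2.ind with | _ a b =>
  induction f using Sym2.ind with | _ x y =>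
  simp only [Sym2.mem_iff] at hu hv
  simp only [edgeGap_mk, edgeVertexDist_mk]
  rcases hu with rfl | rfl <;> rcases hv with rfl | rfl <;> omega

lemma lineGraph_connected (hG : G.Connected) (e : G.edgeSet) : G.lineGraph.Connected := by
  have : Nonempty G.edgeSet := ⟨e⟩
  refine ⟨fun f g => ?_⟩
  obtain ⟨u, hu, v, hv, -⟩ := exists_dist_eq_edgeGap (G := G) f g
  obtain ⟨p⟩ := hG.preconnected u v
  exact ⟨(exists_walk_lineGraph_of_walk p f g hu hv).choose⟩

/-- The edge gap to a fixed edge grows by at most one along a step of the line graph, which gives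
the lower bound for the distance. -/
lemma lineGraph_dist (hG : G.Connected) (e f : G.edgeSet) :
    G.lineGraph.dist e f = if (e : Sym2 V) = f then 0 else edgeGap G e f + 1 := by
  have hL := lineGraph_connected hG e
  split_ifs with hef
  · rw [Subtype.ext hef, SimpleGraph.dist_self]
  apply le_antisymm
  · obtain ⟨u, hu, v, hv, huv⟩ := exists_dist_eq_edgeGap (G := G) e f
    obtain ⟨p, hp⟩ := hG.exists_walk_length_eq_dist u v
    obtain ⟨q, hq⟩ := exists_walk_lineGraph_of_walk p e f hu hv
    have := SimpleGraph.dist_le q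
    omega
  · have := le_add_dist hL
      (φ := fun g : G.edgeSet => if (e : Sym2 V) = g then 0 else edgeGap G e g + 1) ?_ e f
    · simpa [hef] using this
    · intro g h hgh
      obtain ⟨-, w, hwg, hwh⟩ := lineGraph_adj_iff_exists.1 hgh
      split_ifs with h1 h2 h2
      · omega
      · omega
      · have := edgeGap_le (G := G) (h2 ▸ hwg) hwh
        rw [SimpleGraph.dist_self] at this
        omega
      · obtain ⟨u, hu, v, hv, huv⟩ := exists_dist_eq_edgeGap (G := G) e g
        have h3 := edgeGap_le (G := G) hu hwh
        have h4 : G.dist v w ≤ 1 := by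
          by_cases hvw : v = w
          · rw [hvw, SimpleGraph.dist_self]; omega
          · have : (g : Sym2 V) = s(v, w) := (Sym2.mem_and_mem_iff hvw).1 ⟨hv, hwg⟩
            exact (SimpleGraph.dist_eq_one_iff_adj.2 (by simpa [this] using g.2)).le
        have h5 := hG.dist_triangle (u := u) (v := v) (w := w)
        omega

/-- The diagonal contributes zero, and every other unordered pair of edges comes from two ordered
pairs. -/
lemma two_mul_edgeWiener (hG : G.Connected) : 2 * edgeWiener G = wienerSum G univ := by
  have hfib : ∀ p : Sym2 G.edgeSet,
      ∑ x : G.edgeSet × G.edgeSet with s(x.1, x.2) = p, G.lineGraph.dist x.1 x.2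
        = 2 * edgePairDist G p := by
    intro p
    induction p using Sym2.ind with | _ e f =>
    change _ = 2 * G.lineGraph.dist e f
    by_cases hef : e = f
    · subst hef
      rw [SimpleGraph.dist_self]
      refine sum_eq_zero fun x hx => ?_
      have hx := (mem_filter.1 hx).2
      rw [Sym2.eq_iff] at hx
      have : x.1 = x.2 := by rcases hx with hx | hx <;> rw [hx.1, hx.2]
      rw [this, SimpleGraph.dist_self]
    · have : (univ.filter fun x : G.edgeSet × G.edgeSet => s(x.1, x.2) = s(e, f))
          = {(e, f), (f, e)} := by
        ext ⟨x, y⟩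
        simp
      rw [this, sum_pair (by simp [hef])]
      change G.lineGraph.dist e f + G.lineGraph.dist f e = _
      rw [G.lineGraph.dist_comm (u := f), two_mul]
  have hsub : ∀ e : Sym2 V, e ∈ edgesIn G univ ↔ e ∈ G.edgeSet := by simp [edgesIn]
  unfold edgeWiener wienerSum
  rw [mul_sum, sum_congr rfl fun p _ => (hfib p).symm,
    sum_fiberwise univ (fun x : G.edgeSet × G.edgeSet => s(x.1, x.2))
      fun x => G.lineGraph.dist x.1 x.2,
    ← univ_product_univ, sum_product, sum_subtype _ hsub]
  refine sum_congr rfl fun e _ => ?_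
  rw [sum_subtype _ hsub]
  exact sum_congr rfl fun f _ => lineGraph_dist hG e f

/-! ### The cycle on five vertices -/

lemma IsRing.nonempty_iso_cycleGraph {c : ℕ → V} (h : IsRing G univ 5 c) :
    Nonempty (G ≃g cycleGraph 5) := by
  have key : ∀ a b : Fin 5, (a : ℕ) ≤ b →
      (min ((b : ℕ) - a) (5 - (b - a)) = 1 ↔ (cycleGraph 5).Adj a b) := by decide
  have hle : ∀ a b : Fin 5, (a : ℕ) ≤ b → (G.Adj (c a) (c b) ↔ (cycleGraph 5).Adj a b) :=
    fun a b hab => by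
      rw [← key a b hab, ← SimpleGraph.dist_eq_one_iff_adj, h.2.2 a b hab b.2]
  have hinj : Function.Injective fun a : Fin 5 => c a := fun a b hab =>
    Fin.ext (h.injOn a.2 b.2 hab)
  have hsurj : Function.Surjective fun a : Fin 5 => c a := fun v => by
    obtain ⟨i, hi, hv⟩ := h.exists_eq (mem_univ v)
    exact ⟨⟨i, hi⟩, hv⟩
  refine ⟨RelIso.symm ⟨Equiv.ofBijective _ ⟨hinj, hsurj⟩, fun {a b} => ?_⟩⟩
  change G.Adj (c a) (c b) ↔ _
  rcases le_total (a : ℕ) b with hab | hab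
  · exact hle a b hab
  · rw [SimpleGraph.adj_comm, hle b a hab, SimpleGraph.adj_comm]

lemma exists_isRing_of_iso_cycleGraph (hG : G.Connected) (f : G ≃g cycleGraph 5) :
    ∃ c, IsRing G univ 5 c := by
  have key : ∀ a b : Fin 5, (a : ℕ) ≤ b →
      (a = b ∧ min ((b : ℕ) - a) (5 - (b - a)) = 0) ∨
      ((cycleGraph 5).Adj a b ∧ min ((b : ℕ) - a) (5 - (b - a)) = 1) ∨
      (a ≠ b ∧ ¬ (cycleGraph 5).Adj a b ∧ (∃ m, (cycleGraph 5).Adj a m ∧ (cycleGraph 5).Adj m b) ∧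
        min ((b : ℕ) - a) (5 - (b - a)) = 2) := by decide
  have hadj : ∀ a b, G.Adj (f.symm a) (f.symm b) ↔ (cycleGraph 5).Adj a b := fun a b =>
    f.symm.map_rel_iff
  have hdist : ∀ a b : Fin 5, (a : ℕ) ≤ b →
      G.dist (f.symm a) (f.symm b) = min ((b : ℕ) - a) (5 - (b - a)) := by
    intro a b hab
    rcases key a b hab with ⟨h1, h2⟩ | ⟨h1, h2⟩ | ⟨h1, h2, ⟨m, h3, h4⟩, h5⟩
    · rw [h2, h1, SimpleGraph.dist_self]
    · rw [h2, SimpleGraph.dist_eq_one_iff_adj, hadj]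
      exact h1
    · have h6 := SimpleGraph.dist_eq_one_iff_adj.2 ((hadj a m).2 h3)
      have h7 := SimpleGraph.dist_eq_one_iff_adj.2 ((hadj m b).2 h4)
      have h8 := hG.dist_triangle (u := f.symm a) (v := f.symm m) (w := f.symm b)
      have h9 := hG.pos_dist_of_ne fun h => h1 (f.symm.injective h)
      have h10 : G.dist (f.symm a) (f.symm b) ≠ 1 := fun h =>
        h2 ((hadj a b).1 (SimpleGraph.dist_eq_one_iff_adj.1 h))
      omega
  refine ⟨fun i => f.symm (Fin.ofNat 5 i), by omega, ?_, fun i j hij hj => ?_⟩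
  · ext v
    simp only [mem_univ, mem_image, mem_range, true_iff]
    exact ⟨f v, (f v).2, by simp⟩
  · have := hdist ⟨i, by omega⟩ ⟨j, hj⟩ hij
    have hi' : Fin.ofNat 5 i = ⟨i, by omega⟩ := Fin.ext (Nat.mod_eq_of_lt (by omega))
    have hj' : Fin.ofNat 5 j = ⟨j, hj⟩ := Fin.ext (Nat.mod_eq_of_lt hj)
    simpa only [hi', hj'] using this

lemma edgeWiener_of_iso_cycleGraph (hG : G.Connected) (f : G ≃g cycleGraph 5) :
    Fintype.card V = 5 ∧ edgeWiener G = 15 := by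
  obtain ⟨c, hc⟩ := exists_isRing_of_iso_cycleGraph hG f
  have h1 := hc.card
  have h2 := hc.wienerSum (by omega)
  have h3 : ringTransmission 5 = 6 := by decide
  have h4 := two_mul_edgeWiener hG
  rw [card_univ] at h1
  omega

/-! ### The maximal cacti -/

lemma edgeWiener_of_iso_sawGraph (hG : G.Connected) {i j l : ℕ} (hij : i ≤ j) (hji : j ≤ i + 1)
    (f : G ≃g sawGraph i j l) :
    Fintype.card V = 2 * i + 2 * j + l + 1 ∧
      6 * (edgeWiener G : ℤ) = maxWiener (i + l + j) (i + j) := by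
  constructor
  · rw [Fintype.card_congr f.toEquiv]
    simp only [Fintype.card_sum, Fintype.card_fin]
    omega
  · obtain ⟨s, τ, h⟩ := exists_isStrip_of_iso hG f.symm
    have h1 := (h.saw_values hG).2.2
    have h2 : 2 * (edgeWiener G : ℤ) = wienerSum G univ := by exact_mod_cast two_mul_edgeWiener hG
    have h3 : 6 * (edgeWiener G : ℤ) = 3 * wienerSum G univ := by rw [← h2]; ring
    rw [h3, h1, maxWiener]
    obtain rfl | rfl : j = i ∨ j = i + 1 := by omega
    · rw [show (j + j) % 2 = 0 by omega]
      push_cast; ring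
    · rw [show (i + (i + 1)) % 2 = 1 by omega]
      push_cast; ring

/-- The bound in terms of the size `P` of a block decomposition, and the cacti that attain it. -/
theorem MemCacti.edgeWiener_le {n t : ℕ} (hG : MemCacti G n t) (hn : 5 ≤ n) :
    ∃ P, t ≤ P ∧ n = P + t + 1 ∧ 6 * (edgeWiener G : ℤ) ≤ maxWiener P t ∧
      (6 * (edgeWiener G : ℤ) = maxWiener P t →
        (t = 1 ∧ Nonempty (G ≃g cycleGraph 5)) ∨
        ∃ i j l, Nonempty (G ≃g sawGraph i j l) ∧ t = i + j ∧ P = i + l + j ∧ i ≤ j ∧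
          j ≤ i + 1) := by
  obtain ⟨hc, hcard, rfl⟩ := hG
  obtain ⟨P, hP⟩ := hc.exists_built
  have hG := hc.1
  have h1 := hP.card_eq hG
  rw [card_univ, hcard] at h1
  have h2 : 2 * (edgeWiener G : ℤ) = wienerSum G univ := by exact_mod_cast two_mul_edgeWiener hG
  have h3 : 6 * (edgeWiener G : ℤ) = 3 * wienerSum G univ := by rw [← h2]; ring
  refine ⟨P, hP.cycles_le, h1, ?_⟩
  rw [h3]
  rcases hP.bounded hG with ⟨c, h⟩ | h | ⟨h, h'⟩
  · have := h.card
    rw [card_univ] at this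
    omega
  · exact ⟨h.le, fun he => absurd he h.ne⟩
  · refine ⟨h.le, fun _ => ?_⟩
    rcases h' with ⟨c, hc⟩ | ⟨i, l, j, a, b, hs, ht, hPe, hij, hji⟩
    · exact .inl ⟨(hP.unique hG hc.built).2, hc.nonempty_iso_cycleGraph⟩
    · right
      rcases le_total i j with hle | hle
      · obtain ⟨s, τ, hs, -⟩ := hs
        exact ⟨i, j, l, hs.nonempty_iso, ht, hPe, hle, hji⟩
      · obtain ⟨s, τ, hs, -⟩ := hs.reverse
        exact ⟨j, i, l, hs.nonempty_iso, by omega, by omega, hle, hij⟩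

lemma maxWiener_even (P k : ℕ) : (maxWiener P (2 * k) : ℝ) = P ^ 3 + 12 * P ^ 2 * k +
    12 * P * k ^ 2 - 8 * k ^ 3 + 12 * P * k + 48 * k ^ 2 - P - 16 * k := by
  rw [maxWiener, show 2 * k % 2 = 0 by omega]
  push_cast; ring

lemma maxWiener_odd (P k : ℕ) : (maxWiener P (2 * k + 1) : ℝ) = P ^ 3 + 6 * P ^ 2 * (2 * k + 1) +
    3 * P * (2 * k + 1) ^ 2 - (2 * k + 1) ^ 3 + 6 * P * (2 * k + 1) + 12 * (2 * k + 1) ^ 2 - P -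
    8 * (2 * k + 1) - 9 * (P - (2 * k + 1)) := by
  rw [maxWiener, show (2 * k + 1) % 2 = 1 by omega]
  push_cast; ring

end EdgeWienerCacti

theorem mainTheorem2 {V : Type*} [Fintype V] (G : SimpleGraph V) (n t : ℕ) (hn : 5 ≤ n)
    (hG : EdgeWienerCacti.MemCacti G n t) :
    (∀ k : ℕ, t = 2 * k →
      (EdgeWienerCacti.edgeWiener G : ℝ) ≤
          1 / 6 * (n : ℝ) ^ 3 - 1 / 2 * (n : ℝ) ^ 2 + 1 / 3 * (n : ℝ) + (k : ℝ) * (n : ℝ) ^ 2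
            - 4 * (k : ℝ) ^ 2 * (n : ℝ) + 4 / 3 * (k : ℝ) ^ 3 + 8 * (k : ℝ) ^ 2
            - 10 / 3 * (k : ℝ) ∧
        ((EdgeWienerCacti.edgeWiener G : ℝ) =
            1 / 6 * (n : ℝ) ^ 3 - 1 / 2 * (n : ℝ) ^ 2 + 1 / 3 * (n : ℝ) + (k : ℝ) * (n : ℝ) ^ 2
              - 4 * (k : ℝ) ^ 2 * (n : ℝ) + 4 / 3 * (k : ℝ) ^ 3 + 8 * (k : ℝ) ^ 2
              - 10 / 3 * (k : ℝ) ↔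
          Nonempty (G ≃g EdgeWienerCacti.sawGraph k k (n - 4 * k - 1)))) ∧
    (∀ k : ℕ, t = 2 * k + 1 →
      (EdgeWienerCacti.edgeWiener G : ℝ) ≤
          1 / 6 * (n : ℝ) ^ 3 - 13 / 6 * (n : ℝ) + (k : ℝ) * (n : ℝ) ^ 2
            - 4 * (k : ℝ) ^ 2 * (n : ℝ) - 4 * (k : ℝ) * (n : ℝ) + 4 / 3 * (k : ℝ) ^ 3
            + 10 * (k : ℝ) ^ 2 + 35 / 3 * (k : ℝ) + 5 ∧
        ((EdgeWienerCacti.edgeWiener G : ℝ) =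
            1 / 6 * (n : ℝ) ^ 3 - 13 / 6 * (n : ℝ) + (k : ℝ) * (n : ℝ) ^ 2
              - 4 * (k : ℝ) ^ 2 * (n : ℝ) - 4 * (k : ℝ) * (n : ℝ) + 4 / 3 * (k : ℝ) ^ 3
              + 10 * (k : ℝ) ^ 2 + 35 / 3 * (k : ℝ) + 5 ↔
          Nonempty (G ≃g EdgeWienerCacti.sawGraph k (k + 1) (n - 4 * k - 3)) ∨
            Nonempty (G ≃g SimpleGraph.cycleGraph 5))) := by
  obtain ⟨P, htP, rfl, hle, heq⟩ := hG.edgeWiener_le hn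
  have hcard := hG.2.1
  have hconn := hG.1.1
  have hle' : 6 * (EdgeWienerCacti.edgeWiener G : ℝ) ≤ (EdgeWienerCacti.maxWiener P t : ℝ) := by
    exact_mod_cast hle
  constructor
  · rintro k rfl
    rw [EdgeWienerCacti.maxWiener_even] at hle'
    push_cast
    refine ⟨by linarith, fun h => ?_, fun ⟨f⟩ => ?_⟩
    · have hW : 6 * (EdgeWienerCacti.edgeWiener G : ℝ)
          = (EdgeWienerCacti.maxWiener P (2 * k) : ℝ) := by
        rw [EdgeWienerCacti.maxWiener_even, h]; ring
      rcases heq (by exact_mod_cast hW) with ⟨h1, -⟩ | ⟨i, j, l, f, h1, h2, h3, h4⟩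
      · omega
      · obtain rfl : i = k := by omega
        obtain rfl : j = i := by omega
        obtain rfl : l = P + 2 * j + 1 - 4 * j - 1 := by omega
        exact f
    · obtain ⟨h1, h2⟩ := EdgeWienerCacti.edgeWiener_of_iso_sawGraph hconn le_rfl (by omega) f
      have hP : k + (P + 2 * k + 1 - 4 * k - 1) + k = P := by omega
      rw [hP, ← two_mul] at h2
      have hW : 6 * (EdgeWienerCacti.edgeWiener G : ℝ)
          = (EdgeWienerCacti.maxWiener P (2 * k) : ℝ) := by exact_mod_cast h2
      rw [EdgeWienerCacti.maxWiener_even] at hW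
      linarith
  · rintro k rfl
    rw [EdgeWienerCacti.maxWiener_odd] at hle'
    push_cast
    refine ⟨by linarith, fun h => ?_, ?_⟩
    · have hW : 6 * (EdgeWienerCacti.edgeWiener G : ℝ)
          = (EdgeWienerCacti.maxWiener P (2 * k + 1) : ℝ) := by
        rw [EdgeWienerCacti.maxWiener_odd, h]; ring
      rcases heq (by exact_mod_cast hW) with ⟨-, f⟩ | ⟨i, j, l, f, h1, h2, h3, h4⟩
      · exact .inr f
      · obtain rfl : i = k := by omega
        obtain rfl : j = i + 1 := by omega
        obtain rfl : l = P + (2 * i + 1) + 1 - 4 * i - 3 := by omega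
        exact .inl f
    · rintro (⟨⟨f⟩⟩ | ⟨⟨f⟩⟩)
      · obtain ⟨h1, h2⟩ := EdgeWienerCacti.edgeWiener_of_iso_sawGraph hconn (by omega) le_rfl f
        have hP : k + (P + (2 * k + 1) + 1 - 4 * k - 3) + (k + 1) = P := by omega
        rw [hP, ← add_assoc, ← two_mul] at h2
        have hW : 6 * (EdgeWienerCacti.edgeWiener G : ℝ)
            = (EdgeWienerCacti.maxWiener P (2 * k + 1) : ℝ) := by exact_mod_cast h2
        rw [EdgeWienerCacti.maxWiener_odd] at hW
        linarith
      · -- a graph with five vertices and an odd number of cycles has only one cycle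
        obtain ⟨h1, h2⟩ := EdgeWienerCacti.edgeWiener_of_iso_cycleGraph hconn f
        obtain rfl : k = 0 := by omega
        obtain rfl : P = 3 := by omega
        rw [h2]
        norm_num
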